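/- Let $X_1,X_2,\dots$ be i.i.d. real random variables with law $P_0$, whose moment generating function $\mathcal Z(\beta)=\mathbf E[e^{\beta X_1}]$ is finite in a neighbourhood of $0$. Assume that $X_1$ takes (almost surely) values in the lattice $\{kd+\delta : k\in\mathbb Z\}$, where $d>0$ is the maximal span, i.e. the largest $d'>0$ such that $X_1\in\{kd'+\delta' : k\in\mathbb Z\}$ almost surely for some $\delta'\in\mathbb R$. For $\beta$ with $\mathcal Z(\beta)<\infty$ let $P_\beta$ be the probability measure with $\frac{dP_\beta}{dP_0}(x)=e^{\beta x}/\mathcal Z(\beta)$, and let $M$ be the set of all (finite) mean values of the measures $P_\beta$. For $m\in M$ let $\hat\beta(m)$ be the $\beta$ for which $P_\beta$ has mean value $m$, put $P^m=P_{\hat\beta(m)}$, and let $V(m)$ be the variance of $P^m$ and $D(m)=D(P^m\Vert P_0)=\int \ln\frac{dP^m}{dP_0}\,dP^m$ the information divergence. Let $\mu_0=\mathbf E[X_1]$ and $\mu^*=\sup M\in(-\infty,+\infty]$, and let $\Phi$ be the distribution function of the standard Gaussian. Let $\mu_0<\mu<\mu^*$, and put $$c_\mu=\frac{1}{\hat\beta(\mu)}\,\ln\frac{(2D(\mu))^{1/2}}{V(\mu)^{1/2}\,\frac{1-\exp(-d\hat\beta(\mu))}{d}}.$$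 Then, as $n\to\infty$ through those $n$ for which $\mathbf P\{\frac1n\sum_{i=1}^nX_i=\mu\}>0$, $$\mathbf P\Big\{\frac1n\sum_{i=1}^nX_i\ge\mu\Big\}=\Phi\Big(-n^{1/2}\big(2D(\mu-\tfrac{c_\mu}{n})\big)^{1/2}\Big)\Big(1+O\big(\tfrac1n\big)\Big),$$ where the implied constant may depend on $P_0$ and $\mu$ but not on $n$. -/

import Mathlib

open MeasureTheory ProbabilityTheory Filter Asymptotics

noncomputable section

namespace TailApprox

/-- The member `P_β` of the exponential family based on `P₀`: the measure with density
`x ↦ exp (β x) / Z(β)` with respect to `P₀`, where `Z(β) = ∫ exp (β x) dP₀(x)`. -/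
def expFamily (P₀ : Measure ℝ) (β : ℝ) : Measure ℝ :=
  P₀.tilted (fun x => β * x)

/-- `Z(β)` is finite, `P_β` has a mean value, and this mean value equals `m`. -/
def HasMean (P₀ : Measure ℝ) (β m : ℝ) : Prop :=
  Integrable (fun x => Real.exp (β * x)) P₀ ∧
    Integrable (fun x => x) (expFamily P₀ β) ∧ ∫ x, x ∂(expFamily P₀ β) = m

/-- The mean value range `M` of the exponential family based on `P₀`. -/
def meanRange (P₀ : Measure ℝ) : Set ℝ := {m | ∃ β, HasMean P₀ β m}

/-- `μ* = sup M`, possibly `+∞`. -/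
def muStar (P₀ : Measure ℝ) : EReal := sSup ((fun m : ℝ => (m : EReal)) '' meanRange P₀)

open Classical in
/-- The maximum likelihood estimate `β̂(m)`: the `β` such that `P_β` has mean value `m`
(for `m` in the mean value range; the value `0` elsewhere is a dummy). -/
def mle (P₀ : Measure ℝ) (m : ℝ) : ℝ :=
  if h : ∃ β, HasMean P₀ β m then h.choose else 0

/-- `P^m`, the member of the exponential family with mean value `m`. -/
def withMean (P₀ : Measure ℝ) (m : ℝ) : Measure ℝ := expFamily P₀ (mle P₀ m)

/-- `V(m)`, the variance of `P^m`. -/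
def varFun (P₀ : Measure ℝ) (m : ℝ) : ℝ := variance (fun x => x) (withMean P₀ m)

/-- `D(m)`, the information divergence of `P^m` from `P₀` (it is finite on the interior of the
mean value range). -/
def divFun (P₀ : Measure ℝ) (m : ℝ) : ℝ :=
  (InformationTheory.klDiv (withMean P₀ m) P₀).toReal

/-- The distribution function of the standard Gaussian. -/
def stdGaussianCDF (x : ℝ) : ℝ := cdf (gaussianReal 0 1) x

/-- `P₀` is concentrated on the lattice `{k d + δ | k ∈ ℤ}`. -/
def OnLattice (P₀ : Measure ℝ) (d δ : ℝ) : Prop :=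
  ∀ᵐ x ∂P₀, ∃ k : ℤ, x = k * d + δ

/-- `{k d + δ | k ∈ ℤ}`, with `d > 0`, is the lattice of `P₀`: it carries `P₀`, and no coarser
lattice does, that is, `d` is the maximal span. -/
def IsLatticeOf (P₀ : Measure ℝ) (d δ : ℝ) : Prop :=
  0 < d ∧ OnLattice P₀ d δ ∧ ∀ d' δ' : ℝ, 0 < d' → OnLattice P₀ d' δ' → d' ≤ d

/-- The constant `c_m` for a lattice distribution of span `d`. -/
def latticeC (P₀ : Measure ℝ) (d m : ℝ) : ℝ :=
  Real.log (Real.sqrt (2 * divFun P₀ m) /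
      (Real.sqrt (varFun P₀ m) * ((1 - Real.exp (-d * mle P₀ m)) / d))) / mle P₀ m

end TailApprox

end

/-! Both sides have the same leading term, each with relative error O(1/n).

For the probability, take β with P_β of mean μ and standardize the steps to (X_i − μ)/d. When the
mean value μ is attained with positive probability, the standardized sum is almost surely an
integer, and the event says that it is nonnegative. Fourier inversion writes the probability of the
value k as e^{-nD(μ)} e^{-dβk}/(2π) times ∫_{-π}^{π} ψ(t)^n e^{-ikt} dt, where ψ is the
characteristic function of the tilted, centred step. Maximality of the span gives |ψ(t)| < 1 for 0 <
|t| ≤ π, so a Gaussian dominates ψ there. Expanding ψ to third order replaces the integral by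
√(2π/(nv)), v the variance of the tilted step, up to O((1 + k²) n^{-3/2}): the corrections of order
1/n are odd in t and integrate to zero (`norm_integral_pow_mul_exp_sub_le`). The weights e^{-dβk}
make the errors summable, and a geometric series gives the Bahadur–Rao estimate
(`abs_measureReal_sum_nonneg_sub_le`).

For the Gaussian side, Φ(-x) is e^{-x²/2}/(√(2π) x) up to relative error 1/x². Since D has slope β
at μ with quadratic remainder (`divFun_sub_sub_isBigO`), nD(μ − c/n) = nD(μ) − βc + O(1/n). The
shift thus multiplies the tail by e^{βc}, and c_μ is the value for which this factor turns the
Gaussian prefactor into that of Bahadur–Rao (`stdGaussianCDF_div_sub_one_isBigO`). -/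

namespace TailApprox

/-! ### Laplace-type estimates for the inversion integral -/

/-- First-order expansion of `a ^ (n + 1)` around `b`, with quadratic remainder. -/
lemma norm_pow_sub_pow_sub_le {a b : ℂ} {r : ℝ} (ha : ‖a‖ ≤ r) (hb : ‖b‖ ≤ r) (n : ℕ) :
    r * ‖a ^ (n + 1) - b ^ (n + 1) - (n + 1) * b ^ n * (a - b)‖
      ≤ (n + 1) ^ 2 * r ^ n * ‖a - b‖ ^ 2 := by
  have hr : 0 ≤ r := (norm_nonneg a).trans ha
  induction n with
  | zero => simp
  | succ n ih =>
    have key : a ^ (n + 1 + 1) - b ^ (n + 1 + 1) - ((n + 1 : ℕ) + 1) * b ^ (n + 1) * (a - b)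
        = a * (a ^ (n + 1) - b ^ (n + 1) - (n + 1) * b ^ n * (a - b))
          + (n + 1) * b ^ n * (a - b) ^ 2 := by push_cast; ring
    rw [key]
    set E := a ^ (n + 1) - b ^ (n + 1) - (n + 1) * b ^ n * (a - b)
    have h1 : ‖a * E + (n + 1) * b ^ n * (a - b) ^ 2‖
        ≤ r * ‖E‖ + (n + 1) * r ^ n * ‖a - b‖ ^ 2 := by
      refine (norm_add_le _ _).trans ?_
      have : ‖(n + 1 : ℂ)‖ = n + 1 := by exact_mod_cast Complex.norm_natCast (n + 1)
      rw [norm_mul, norm_mul, norm_mul, norm_pow, norm_pow, this]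
      gcongr
    calc r * ‖a * E + (n + 1) * b ^ n * (a - b) ^ 2‖
        ≤ r * (r * ‖E‖ + (n + 1) * r ^ n * ‖a - b‖ ^ 2) := by gcongr
      _ ≤ r * ((n + 1) ^ 2 * r ^ n * ‖a - b‖ ^ 2 + (n + 1) * r ^ n * ‖a - b‖ ^ 2) := by gcongr
      _ = ((n + 1) ^ 2 + (n + 1)) * (r ^ (n + 1) * ‖a - b‖ ^ 2) := by ring
      _ ≤ ((n + 1 : ℕ) + 1) ^ 2 * (r ^ (n + 1) * ‖a - b‖ ^ 2) := by
          gcongr; push_cast; nlinarith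
      _ = _ := by ring

lemma exists_norm_le_mul_pow_of_isBigO {f : ℝ → ℂ} (hf : Continuous f) {m : ℕ} (L : ℝ)
    (hO : f =O[nhds 0] fun t => t ^ m) :
    ∃ K, 0 ≤ K ∧ ∀ t, |t| ≤ L → ‖f t‖ ≤ K * |t| ^ m := by
  obtain ⟨K, hK⟩ := hO.bound
  obtain ⟨ε, hε, h⟩ := Metric.eventually_nhds_iff.1 hK
  obtain ⟨B, hB⟩ := (isCompact_Icc (a := -L) (b := L)).exists_bound_of_continuousOn
    hf.continuousOn
  refine ⟨|K| + |B| / ε ^ m, by positivity, fun t ht => ?_⟩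
  have h0 : 0 ≤ |t| ^ m := by positivity
  rcases lt_or_ge |t| ε with h1 | h1
  · have := h (y := t) (by simpa using h1)
    rw [norm_pow, Real.norm_eq_abs] at this
    have h2 : 0 ≤ |B| / ε ^ m := by positivity
    nlinarith [le_abs_self K]
  · have h3 : ε ^ m ≤ |t| ^ m := by gcongr
    have h4 : |B| ≤ |B| / ε ^ m * |t| ^ m := by
      rw [div_mul_eq_mul_div, le_div_iff₀ (by positivity)]
      gcongr
    have := hB t (by simpa [abs_le] using ht)
    nlinarith [le_abs_self B, abs_nonneg K]

/-- A continuous function of modulus less than one away from the origin, with negative definite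
second order term at the origin, is dominated by a Gaussian on a compact interval. -/
lemma exists_norm_le_exp_neg_mul_sq {ψ : ℝ → ℂ} (hψ : Continuous ψ) {v L : ℝ} (hv : 0 < v)
    (hL : 0 < L) (hO : (fun t : ℝ => ψ t - (1 - v * t ^ 2 / 2)) =o[nhds 0] fun t => t ^ 2)
    (hlt : ∀ t, 0 < |t| → |t| ≤ L → ‖ψ t‖ < 1) :
    ∃ c, 0 < c ∧ c ≤ v / 4 ∧ ∀ t, |t| ≤ L → ‖ψ t‖ ≤ Real.exp (-c * t ^ 2) := by
  have h1 := hO.def (show 0 < v / 4 by positivity)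
  have h2 : ∀ᶠ t : ℝ in nhds 0, v * t ^ 2 / 2 < 1 := by
    have : Tendsto (fun t : ℝ => v * t ^ 2 / 2) (nhds 0) (nhds (v * 0 ^ 2 / 2)) :=
      Continuous.tendsto (by fun_prop) 0
    exact this.eventually_lt_const (by norm_num)
  obtain ⟨ε, hε, h⟩ := Metric.eventually_nhds_iff.1 (h1.and h2)
  have hcpt : IsCompact {t : ℝ | ε ≤ |t| ∧ |t| ≤ L} := by
    refine (isCompact_Icc (a := -L) (b := L)).of_isClosed_subset ?_ ?_
    · exact (isClosed_le continuous_const continuous_abs).inter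
        (isClosed_le continuous_abs continuous_const)
    · intro t ht; simpa [abs_le] using ht.2
  obtain ⟨q, hq0, hq1, hq⟩ : ∃ q, 0 < q ∧ q < 1 ∧ ∀ t, ε ≤ |t| → |t| ≤ L → ‖ψ t‖ ≤ q := by
    rcases Set.eq_empty_or_nonempty {t : ℝ | ε ≤ |t| ∧ |t| ≤ L} with h0 | h0
    · refine ⟨1 / 2, by norm_num, by norm_num, fun t h3 h4 => ?_⟩
      have : t ∈ ({t : ℝ | ε ≤ |t| ∧ |t| ≤ L} : Set ℝ) := ⟨h3, h4⟩
      simp [h0] at this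
    · obtain ⟨s, hs, hmax⟩ := hcpt.exists_isMaxOn h0 hψ.norm.continuousOn
      refine ⟨max ‖ψ s‖ (1 / 2), by positivity, ?_, fun t h3 h4 => ?_⟩
      · exact max_lt (hlt s (hε.trans_le hs.1) hs.2) (by norm_num)
      · exact le_max_of_le_left (hmax ⟨h3, h4⟩)
  have hlog : 0 < -Real.log q := by linarith [Real.log_neg hq0 hq1]
  -- Near 0 the remainder may consume half of the decay v t²/2, which leaves v/4. Away from 0 the
  -- second entry of the minimum ensures exp(-cL²) ≥ q.
  refine ⟨min (v / 4) (-Real.log q / L ^ 2), by positivity, min_le_left _ _, fun t ht => ?_⟩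
  set c := min (v / 4) (-Real.log q / L ^ 2)
  rcases lt_or_ge |t| ε with h3 | h3
  · obtain ⟨h4, h5⟩ := h (y := t) (by simpa using h3)
    have h6 : ‖ψ t‖ ≤ 1 - v / 4 * t ^ 2 := by
      have : ‖(1 - v * t ^ 2 / 2 : ℂ)‖ = 1 - v * t ^ 2 / 2 := by
        rw [show (1 - v * t ^ 2 / 2 : ℂ) = ((1 - v * t ^ 2 / 2 : ℝ) : ℂ) by push_cast; ring,
          Complex.norm_real, Real.norm_of_nonneg (by linarith)]
      have h7 := norm_sub_norm_le (ψ t) (1 - v * t ^ 2 / 2 : ℂ)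
      rw [norm_pow, Real.norm_eq_abs, sq_abs] at h4
      linarith
    have h8 := Real.add_one_le_exp (-c * t ^ 2)
    have h9 : c * t ^ 2 ≤ v / 4 * t ^ 2 := by gcongr; exact min_le_left _ _
    linarith
  · refine (hq t h3 ht).trans ?_
    rw [← Real.log_le_iff_le_exp hq0]
    have h9 : c * t ^ 2 ≤ -Real.log q / L ^ 2 * L ^ 2 := by
      rw [← sq_abs t]
      gcongr
      exact min_le_right _ _
    rw [div_mul_cancel₀ _ (by positivity)] at h9
    linarith

lemma cexp_neg_half_sq_sub_isBigO (v : ℝ) :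
    (fun t : ℝ => Complex.exp (-(v * t ^ 2 / 2 : ℂ)) - (1 - v * t ^ 2 / 2))
      =O[nhds 0] fun t => t ^ 4 := by
  have h2 : ∀ᶠ t : ℝ in nhds 0, |v * t ^ 2 / 2| < 1 := by
    have : Tendsto (fun t : ℝ => |v * t ^ 2 / 2|) (nhds 0) (nhds |v * 0 ^ 2 / 2|) :=
      Continuous.tendsto (by fun_prop) 0
    exact this.eventually_lt_const (by norm_num)
  refine IsBigO.of_bound (v ^ 2 / 4) ?_
  filter_upwards [h2] with t ht
  have := Complex.exp_bound_sq 0 (-(v * t ^ 2 / 2 : ℂ)) (by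
    rw [norm_neg, show (v * t ^ 2 / 2 : ℂ) = ((v * t ^ 2 / 2 : ℝ) : ℂ) by push_cast; ring,
      Complex.norm_real]
    exact ht.le)
  simp only [zero_add, Complex.exp_zero, norm_one, one_mul, norm_neg, smul_eq_mul, mul_one] at this
  rw [show (v * t ^ 2 / 2 : ℂ) = ((v * t ^ 2 / 2 : ℝ) : ℂ) by push_cast; ring] at this ⊢
  rw [show Complex.exp (-((v * t ^ 2 / 2 : ℝ) : ℂ)) - (1 - ((v * t ^ 2 / 2 : ℝ) : ℂ))
    = Complex.exp (-((v * t ^ 2 / 2 : ℝ) : ℂ)) - 1 - -((v * t ^ 2 / 2 : ℝ) : ℂ) by ring]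
  refine this.trans (le_of_eq ?_)
  rw [Complex.norm_real, Real.norm_eq_abs, sq_abs, norm_pow, Real.norm_eq_abs, ← abs_pow,
    abs_of_nonneg (by positivity)]
  ring

lemma integral_symm_eq_zero_of_odd {f : ℝ → ℂ} (hf : ∀ t, f (-t) = -f t) (L : ℝ) :
    ∫ t in -L..L, f t = 0 := by
  have h := intervalIntegral.integral_comp_neg (a := -L) (b := L) f
  simp only [hf, intervalIntegral.integral_neg, neg_neg] at h
  exact self_eq_neg.1 h.symm

lemma integrable_pow_mul_exp_neg_mul_sq {c : ℝ} (hc : 0 < c) (m : ℕ) :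
    Integrable fun s : ℝ => s ^ m * Real.exp (-c * s ^ 2) := by
  have := integrable_rpow_mul_exp_neg_mul_sq hc (s := m) (by
    have : (0 : ℝ) ≤ m := by positivity
    linarith)
  simpa using this

/-- Scaling of Gaussian moments. -/
lemma intervalIntegral_comp_sqrt_mul_le {g : ℝ → ℝ} (hg : Integrable g) (hg0 : ∀ s, 0 ≤ g s)
    {x : ℝ} (hx : 0 < x) {a b : ℝ} (hab : a ≤ b) :
    ∫ t in a..b, g (√x * t) ≤ (√x)⁻¹ * ∫ s, g s := by
  have hs : 0 < √x := Real.sqrt_pos.2 hx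
  rw [intervalIntegral.integral_of_le hab]
  refine (setIntegral_le_integral (hg.comp_mul_left' hs.ne') (ae_of_all _ fun t => hg0 _)).trans ?_
  rw [Measure.integral_comp_mul_left, abs_of_pos (by positivity), smul_eq_mul]

/-- On the missing tail t²/L² ≥ 1 can be inserted, and the second Gaussian moment scales like
x^{-3/2}, the order of error allowed in the inversion integral. -/
lemma abs_intervalIntegral_gaussian_sub_le {v L : ℝ} (hv : 0 < v) (hL : 0 < L) :
    ∃ C, 0 ≤ C ∧ ∀ x : ℝ, 0 < x →
      |(∫ t in -L..L, Real.exp (-(x * v / 2) * t ^ 2)) - √(2 * Real.pi / (x * v))|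
        ≤ C * (x * √x)⁻¹ := by
  set M := ∫ s : ℝ, s ^ 2 * Real.exp (-(v / 2) * s ^ 2) with hM
  have hM0 : 0 ≤ M := integral_nonneg fun s => by positivity
  refine ⟨M / L ^ 2, by positivity, fun x hx => ?_⟩
  have hx' : 0 < x * v / 2 := by positivity
  have hint := integrable_exp_neg_mul_sq hx'
  have hG := integral_gaussian (x * v / 2)
  rw [show Real.pi / (x * v / 2) = 2 * Real.pi / (x * v) by field_simp] at hG
  rw [← hG, intervalIntegral.integral_of_le (by linarith),
    ← integral_add_compl (measurableSet_Ioc (a := -L) (b := L)) hint]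
  rw [sub_add_cancel_left, abs_neg, abs_of_nonneg (setIntegral_nonneg
    (measurableSet_Ioc.compl) fun s _ => by positivity)]
  have hs : 0 < √x := Real.sqrt_pos.2 hx
  have hi2 : Integrable fun t : ℝ => (L ^ 2)⁻¹ * (x⁻¹ *
      ((√x * t) ^ 2 * Real.exp (-(v / 2) * (√x * t) ^ 2))) :=
    (((integrable_pow_mul_exp_neg_mul_sq (half_pos hv) 2).comp_mul_left' hs.ne').const_mul
      _).const_mul _
  calc ∫ t in (Set.Ioc (-L) L)ᶜ, Real.exp (-(x * v / 2) * t ^ 2)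
      ≤ ∫ t in (Set.Ioc (-L) L)ᶜ, (L ^ 2)⁻¹ * (x⁻¹ *
        ((√x * t) ^ 2 * Real.exp (-(v / 2) * (√x * t) ^ 2))) := by
        refine setIntegral_mono_on hint.integrableOn hi2.integrableOn measurableSet_Ioc.compl
          fun t ht => ?_
        have ht2 : L ^ 2 ≤ t ^ 2 := by
          rw [Set.mem_compl_iff, Set.mem_Ioc, not_and_or, not_lt, not_le] at ht
          rcases ht with ht | ht <;> nlinarith
        rw [mul_pow, Real.sq_sqrt hx.le, show -(v / 2) * (x * t ^ 2) = -(x * v / 2) * t ^ 2 by ring,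
          show (L ^ 2)⁻¹ * (x⁻¹ * (x * t ^ 2 * Real.exp (-(x * v / 2) * t ^ 2)))
            = t ^ 2 / L ^ 2 * Real.exp (-(x * v / 2) * t ^ 2) by field_simp]
        exact le_mul_of_one_le_left (Real.exp_pos _).le ((one_le_div (by positivity)).2 ht2)
    _ ≤ ∫ t, (L ^ 2)⁻¹ * (x⁻¹ *
        ((√x * t) ^ 2 * Real.exp (-(v / 2) * (√x * t) ^ 2))) :=
        setIntegral_le_integral hi2 (ae_of_all _ fun t => by dsimp only; positivity)
    _ = M / L ^ 2 * (x * √x)⁻¹ := by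
        rw [integral_const_mul, integral_const_mul, Measure.integral_comp_mul_left
          (fun s : ℝ => s ^ 2 * Real.exp (-(v / 2) * s ^ 2)), abs_of_pos (by positivity),
          smul_eq_mul, ← hM]
        field_simp

lemma norm_exp_mul_I_sub_one_le (y : ℝ) : ‖Complex.exp (y * Complex.I) - 1‖ ≤ |y| := by
  have := Real.norm_exp_I_mul_ofReal_sub_one_le (x := y)
  rwa [mul_comm] at this

lemma norm_exp_mul_I_sub_one_sub_le (y : ℝ) :
    ‖Complex.exp (y * Complex.I) - 1 - y * Complex.I‖ ≤ 3 * y ^ 2 := by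
  have hy : ‖(y * Complex.I : ℂ)‖ = |y| := by simp
  rcases le_total |y| 1 with h | h
  · have := Complex.exp_bound_sq 0 (y * Complex.I) (by rwa [hy])
    simp only [zero_add, Complex.exp_zero, norm_one, one_mul, smul_eq_mul, mul_one, hy,
      sq_abs] at this
    nlinarith [sq_nonneg y]
  · refine (norm_sub_le _ _).trans ?_
    rw [hy]
    nlinarith [norm_exp_mul_I_sub_one_le y, sq_abs y]

/-- The integrand of the inversion formula, minus its Gaussian approximation and two odd terms. -/
lemma norm_pow_mul_exp_sub_gaussian_le {ψ : ℝ → ℂ} {v c K : ℝ} {g : ℂ} {L : ℝ}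
    (hc : 0 < c) (hcv : c ≤ v / 4) (hK : 0 ≤ K)
    (hdom : ∀ t, |t| ≤ L → ‖ψ t‖ ≤ Real.exp (-c * t ^ 2))
    (hO : ∀ t, |t| ≤ L → ‖ψ t - Complex.exp (-(v * t ^ 2 / 2 : ℂ)) - g * t ^ 3‖ ≤ K * |t| ^ 4) :
    ∃ C, 0 ≤ C ∧ ∀ (n : ℕ) (k t : ℝ), |t| ≤ L →
      ‖ψ t ^ (n + 1) * Complex.exp ((-(k * t) : ℝ) * Complex.I)
        - Complex.exp (-(v * t ^ 2 / 2 : ℂ)) ^ (n + 1)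
        + (k * t * Complex.I * Complex.exp (-(v * t ^ 2 / 2 : ℂ)) ^ (n + 1)
          - g * (n + 1) * t ^ 3 * Complex.exp (-(v * t ^ 2 / 2 : ℂ)) ^ n)‖
      ≤ C * (1 + k ^ 2) * (((n + 1) ^ 2 * t ^ 6 + (n + 1) * t ^ 4 + t ^ 2) *
          Real.exp (-c * t ^ 2) ^ (n + 1)) := by
  -- A lower bound for r on |t| ≤ L: dividing by it supplies the factors of r that are missing
  -- whenever a bound carries fewer than n + 1 of them.
  set r0 := Real.exp (-c * L ^ 2) with hr0
  have hr0pos : 0 < r0 := Real.exp_pos _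
  refine ⟨(K * L + ‖g‖) ^ 2 / r0 ^ 2 + K / r0 + 3 + ‖g‖ / r0, by positivity, fun n k t ht => ?_⟩
  set b := Complex.exp (-(v * t ^ 2 / 2 : ℂ)) with hb
  set e := Complex.exp ((-(k * t) : ℝ) * Complex.I) with he
  set a := ψ t
  set r := Real.exp (-c * t ^ 2) with hr
  have hrpos : 0 < r := Real.exp_pos _
  have hr0r : r0 ≤ r := by
    rw [hr0, hr, Real.exp_le_exp, ← sq_abs t]
    nlinarith [mul_le_mul_of_nonneg_left (pow_le_pow_left₀ (abs_nonneg t) ht 2) hc.le]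
  have har : ‖a‖ ≤ r := hdom t ht
  have hbr : ‖b‖ ≤ r := by
    rw [hb, show (-(v * t ^ 2 / 2) : ℂ) = ((-(v * t ^ 2 / 2) : ℝ) : ℂ) by push_cast; ring,
      ← Complex.ofReal_exp, Complex.norm_real, Real.norm_of_nonneg (Real.exp_pos _).le,
      hr, Real.exp_le_exp]
    nlinarith [mul_le_mul_of_nonneg_right hcv (sq_nonneg t), mul_nonneg hc.le (sq_nonneg t)]
  have hen : ‖e‖ = 1 := Complex.norm_exp_ofReal_mul_I _
  have he1 : ‖e - 1‖ ≤ |k| * |t| := by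
    have := norm_exp_mul_I_sub_one_le (-(k * t))
    rwa [abs_neg, abs_mul] at this
  have he2 : ‖e - 1 + k * t * Complex.I‖ ≤ 3 * (k ^ 2 * t ^ 2) := by
    have := norm_exp_mul_I_sub_one_sub_le (-(k * t))
    rw [neg_sq, mul_pow] at this
    rw [he]
    convert! this using 2
    rw [Complex.ofReal_neg, Complex.ofReal_mul]
    ring
  have h4 : ‖a - b - g * t ^ 3‖ ≤ K * |t| ^ 4 := hO t ht
  have h3 : ‖a - b‖ ≤ (K * L + ‖g‖) * |t| ^ 3 := by
    calc ‖a - b‖ = ‖(a - b - g * t ^ 3) + g * t ^ 3‖ := by ring_nf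
      _ ≤ K * |t| ^ 4 + ‖g‖ * |t| ^ 3 := by
          refine (norm_add_le _ _).trans (add_le_add h4 ?_)
          simp
      _ ≤ _ := by
          nlinarith [mul_le_mul_of_nonneg_left ht (mul_nonneg hK (pow_nonneg (abs_nonneg t) 3))]
  have h6 : ‖a - b‖ ^ 2 ≤ (K * L + ‖g‖) ^ 2 * t ^ 6 := by
    calc ‖a - b‖ ^ 2 ≤ ((K * L + ‖g‖) * |t| ^ 3) ^ 2 := by gcongr
      _ = (K * L + ‖g‖) ^ 2 * (|t| ^ 2) ^ 3 := by ring
      _ = _ := by rw [sq_abs]; ring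
  have ht4 : |t| ^ 4 = t ^ 4 := by
    rw [show |t| ^ 4 = (|t| ^ 2) ^ 2 by ring, sq_abs]; ring
  have hN : ‖(n + 1 : ℂ)‖ = n + 1 := by exact_mod_cast Complex.norm_natCast (n + 1)
  have hbn : ‖b ^ n‖ ≤ r ^ (n + 1) / r0 := by
    rw [norm_pow, le_div_iff₀ hr0pos, pow_succ]
    gcongr
  -- Four errors remain once the two odd terms are removed: linearizing the power, the quartic
  -- Taylor remainder of ψ, the second-order remainder of the phase, and the product of the cubic
  -- term with the phase increment.
  have key : a ^ (n + 1) * e - b ^ (n + 1) + (k * t * Complex.I * b ^ (n + 1)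
      - g * (n + 1) * t ^ 3 * b ^ n)
      = e * (a ^ (n + 1) - b ^ (n + 1) - (n + 1) * b ^ n * (a - b))
        + e * ((n + 1) * b ^ n * (a - b - g * t ^ 3))
        + b ^ (n + 1) * (e - 1 + k * t * Complex.I)
        + g * (n + 1) * t ^ 3 * b ^ n * (e - 1) := by ring
  rw [key]
  have T1 : ‖e * (a ^ (n + 1) - b ^ (n + 1) - (n + 1) * b ^ n * (a - b))‖
      ≤ (K * L + ‖g‖) ^ 2 / r0 ^ 2 * (((n + 1) ^ 2 * t ^ 6) * r ^ (n + 1)) := by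
    rw [norm_mul, hen, one_mul]
    have h := norm_pow_sub_pow_sub_le har hbr n
    rw [div_mul_eq_mul_div, le_div_iff₀ (by positivity)]
    set E := ‖a ^ (n + 1) - b ^ (n + 1) - (n + 1) * b ^ n * (a - b)‖
    calc E * r0 ^ 2 ≤ E * r ^ 2 := by gcongr
      _ = r * (r * E) := by ring
      _ ≤ r * ((n + 1) ^ 2 * r ^ n * ((K * L + ‖g‖) ^ 2 * t ^ 6)) := by
          refine mul_le_mul_of_nonneg_left (h.trans ?_) hrpos.le
          exact mul_le_mul_of_nonneg_left h6 (by positivity)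
      _ = _ := by ring
  have T2 : ‖e * ((n + 1) * b ^ n * (a - b - g * t ^ 3))‖
      ≤ K / r0 * ((n + 1) * t ^ 4 * r ^ (n + 1)) := by
    rw [norm_mul, hen, one_mul, norm_mul, norm_mul, hN]
    calc (n + 1) * ‖b ^ n‖ * ‖a - b - g * t ^ 3‖
        ≤ (n + 1) * (r ^ (n + 1) / r0) * (K * t ^ 4) := by
          gcongr
          rwa [← ht4]
      _ = _ := by ring
  have T3 : ‖b ^ (n + 1) * (e - 1 + k * t * Complex.I)‖
      ≤ 3 * k ^ 2 * (t ^ 2 * r ^ (n + 1)) := by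
    rw [norm_mul, norm_pow]
    calc ‖b‖ ^ (n + 1) * ‖e - 1 + k * t * Complex.I‖
        ≤ r ^ (n + 1) * (3 * (k ^ 2 * t ^ 2)) := by gcongr
      _ = _ := by ring
  have T4 : ‖g * (n + 1) * t ^ 3 * b ^ n * (e - 1)‖
      ≤ ‖g‖ / r0 * |k| * ((n + 1) * t ^ 4 * r ^ (n + 1)) := by
    rw [norm_mul, norm_mul, norm_mul, norm_mul, hN, norm_pow (t : ℂ), Complex.norm_real,
      Real.norm_eq_abs]
    calc ‖g‖ * (n + 1) * |t| ^ 3 * ‖b ^ n‖ * ‖e - 1‖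
        ≤ ‖g‖ * (n + 1) * |t| ^ 3 * (r ^ (n + 1) / r0) * (|k| * |t|) := by gcongr
      _ = ‖g‖ / r0 * |k| * ((n + 1) * |t| ^ 4 * r ^ (n + 1)) := by ring
      _ = _ := by rw [ht4]
  have hk : |k| ≤ 1 + k ^ 2 := by nlinarith [sq_abs k, sq_nonneg (|k| - 1)]
  have hk1 : 1 ≤ 1 + k ^ 2 := by nlinarith [sq_nonneg k]
  have hk2 : k ^ 2 ≤ 1 + k ^ 2 := by linarith
  set A := (n + 1 : ℝ) ^ 2 * t ^ 6 * r ^ (n + 1) with hA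
  set B := (n + 1 : ℝ) * t ^ 4 * r ^ (n + 1) with hB
  set D := t ^ 2 * r ^ (n + 1) with hD
  have hA0 : 0 ≤ A := by rw [hA, show t ^ 6 = (t ^ 3) ^ 2 by ring]; positivity
  have hB0 : 0 ≤ B := by rw [hB, show t ^ 4 = (t ^ 2) ^ 2 by ring]; positivity
  have hD0 : 0 ≤ D := by positivity
  have hS : ∀ {p q x : ℝ}, 0 ≤ p → q ≤ 1 + k ^ 2 → 0 ≤ x → x ≤ A + B + D →
      p * q * x ≤ p * ((1 + k ^ 2) * (A + B + D)) := by
    intro p q x hp hq hx hxs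
    rw [mul_assoc]
    exact mul_le_mul_of_nonneg_left (mul_le_mul hq hxs hx (by positivity)) hp
  have S1 := hS (p := (K * L + ‖g‖) ^ 2 / r0 ^ 2) (by positivity) hk1 hA0 (by linarith)
  have S2 := hS (p := K / r0) (by positivity) hk1 hB0 (by linarith)
  have S3 := hS (p := 3) (by positivity) hk2 hD0 (by linarith)
  have S4 := hS (p := ‖g‖ / r0) (by positivity) hk hB0 (by linarith)
  rw [mul_one] at S1 S2
  have hfin : ((n + 1 : ℝ) ^ 2 * t ^ 6 + (n + 1) * t ^ 4 + t ^ 2) * r ^ (n + 1) = A + B + D := by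
    rw [hA, hB, hD]; ring
  rw [hfin]
  refine (norm_add_le _ _).trans ((add_le_add ((norm_add_le _ _).trans
    (add_le_add ((norm_add_le _ _).trans (add_le_add (T1.trans S1) (T2.trans S2)))
      (T3.trans S3))) (T4.trans S4)).trans (le_of_eq ?_))
  ring

/-- Asymptotics of the inversion integral of the `n`-th power of a characteristic function. -/
lemma norm_integral_pow_mul_exp_sub_le {ψ : ℝ → ℂ} (hψ : Continuous ψ) {v L : ℝ} (hv : 0 < v)
    (hL : 0 < L) (g : ℂ)
    (hO : (fun t : ℝ => ψ t - (1 - v * t ^ 2 / 2 + g * t ^ 3)) =O[nhds 0] fun t => t ^ 4)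
    (hlt : ∀ t, 0 < |t| → |t| ≤ L → ‖ψ t‖ < 1) :
    ∃ C, 0 ≤ C ∧ ∀ (n : ℕ) (k : ℝ),
      ‖(∫ t in -L..L, ψ t ^ (n + 1) * Complex.exp ((-(k * t) : ℝ) * Complex.I))
        - (√(2 * Real.pi / ((n + 1) * v)) : ℝ)‖
      ≤ C * (1 + k ^ 2) * ((n + 1) * √(n + 1))⁻¹ := by
  have hpow : ∀ {p q : ℕ}, q < p → (fun t : ℝ => t ^ p) =o[nhds 0] fun t => t ^ q :=
    fun h => isLittleO_pow_pow h
  have hg3 : (fun t : ℝ => g * (t : ℂ) ^ 3) =O[nhds 0] fun t : ℝ => t ^ 3 := by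
    refine IsBigO.of_bound ‖g‖ (Eventually.of_forall fun t => ?_)
    simp
  have hlit : (fun t : ℝ => ψ t - (1 - v * t ^ 2 / 2)) =o[nhds 0] fun t => t ^ 2 := by
    have := (hO.trans_isLittleO (hpow (by norm_num : 2 < 4))).add
      (hg3.trans_isLittleO (hpow (by norm_num : 2 < 3)))
    refine this.congr_left fun t => by ring
  obtain ⟨c, hc, hcv, hdom⟩ := exists_norm_le_exp_neg_mul_sq hψ hv hL hlit hlt
  have hO' : (fun t : ℝ => ψ t - Complex.exp (-(v * t ^ 2 / 2 : ℂ)) - g * t ^ 3)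
      =O[nhds 0] fun t => t ^ 4 :=
    (hO.sub (cexp_neg_half_sq_sub_isBigO v)).congr_left fun t => by ring
  obtain ⟨K, hK, hKb⟩ := exists_norm_le_mul_pow_of_isBigO (by fun_prop) L hO'
  obtain ⟨C, hC, hR⟩ := norm_pow_mul_exp_sub_gaussian_le hc hcv hK hdom hKb
  obtain ⟨C', hC', hgauss⟩ := abs_intervalIntegral_gaussian_sub_le hv hL
  set G : ℝ → ℝ := fun s => (s ^ 6 + s ^ 4 + s ^ 2) * Real.exp (-c * s ^ 2) with hG
  have hGi : Integrable G := by
    have := ((integrable_pow_mul_exp_neg_mul_sq hc 6).add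
      (integrable_pow_mul_exp_neg_mul_sq hc 4)).add (integrable_pow_mul_exp_neg_mul_sq hc 2)
    refine this.congr (ae_of_all _ fun s => ?_)
    simp only [hG, Pi.add_apply]; ring
  have hG0 : ∀ s, 0 ≤ G s := fun s => by
    simp only [hG]
    rw [show s ^ 6 = (s ^ 3) ^ 2 by ring, show s ^ 4 = (s ^ 2) ^ 2 by ring]
    positivity
  have hM : 0 ≤ ∫ s, G s := integral_nonneg hG0
  refine ⟨C * (∫ s, G s) + C', by positivity, fun n k => ?_⟩
  have hN : (0 : ℝ) < n + 1 := by positivity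
  set b : ℝ → ℂ := fun t => Complex.exp (-(v * t ^ 2 / 2 : ℂ)) with hb
  have hbc : Continuous b := by fun_prop
  set F : ℝ → ℂ := fun t => ψ t ^ (n + 1) * Complex.exp ((-(k * t) : ℝ) * Complex.I) with hF
  have hFc : Continuous F := by fun_prop
  -- First-order contributions of the phase and of the cubic Taylor term. Bounded in modulus they
  -- would cost order 1/(n + 1), which is too much; but b is even, so H is odd and integrates to
  -- zero.
  set H : ℝ → ℂ := fun t => k * t * Complex.I * b t ^ (n + 1)
    - g * (n + 1) * t ^ 3 * b t ^ n with hH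
  have hHc : Continuous H := by fun_prop
  have hHodd : ∫ t in -L..L, H t = 0 := by
    refine integral_symm_eq_zero_of_odd (fun t => ?_) L
    simp only [hH, hb]
    push_cast
    rw [neg_sq]
    ring
  have hsplit : ∫ t in -L..L, (F t - b t ^ (n + 1) + H t)
      = (∫ t in -L..L, F t) - ∫ t in -L..L, b t ^ (n + 1) := by
    rw [intervalIntegral.integral_add, intervalIntegral.integral_sub, hHodd, add_zero]
    all_goals exact Continuous.intervalIntegrable (by fun_prop) _ _
  have hbint : ∫ t in -L..L, b t ^ (n + 1)
      = ((∫ t in -L..L, Real.exp (-((n + 1) * v / 2) * t ^ 2) : ℝ) : ℂ) := by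
    rw [← intervalIntegral.integral_ofReal]
    refine intervalIntegral.integral_congr fun t _ => ?_
    simp only [hb]
    rw [← Complex.exp_nat_mul, Complex.ofReal_exp]
    congr 1
    push_cast; ring
  have hRint : ‖∫ t in -L..L, (F t - b t ^ (n + 1) + H t)‖
      ≤ C * (1 + k ^ 2) * (((n : ℝ) + 1) * √(n + 1))⁻¹ * ∫ s, G s := by
    have hle : -L ≤ L := by linarith
    -- Substituting s = √(n + 1) t turns each monomial of the error bound into (n + 1)⁻¹ times a
    -- fixed Gaussian moment density; the Jacobian supplies the remaining (n + 1)^{-1/2}.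
    calc _ ≤ ∫ t in -L..L, C * (1 + k ^ 2) * ((n + 1 : ℝ)⁻¹ * G (√(n + 1) * t)) := by
          refine intervalIntegral.norm_integral_le_of_norm_le hle (ae_of_all _ fun t ht => ?_) ?_
          · refine (hR n k t (abs_le.2 ⟨ht.1.le, ht.2⟩)).trans (le_of_eq ?_)
            congr 1
            simp only [hG, mul_pow]
            rw [show √(n + 1 : ℝ) ^ 6 = (√(n + 1 : ℝ) ^ 2) ^ 3 by ring,
              show √(n + 1 : ℝ) ^ 4 = (√(n + 1 : ℝ) ^ 2) ^ 2 by ring, Real.sq_sqrt hN.le,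
              ← Real.exp_nat_mul]
            push_cast
            rw [show (n + 1 : ℝ) * (-c * t ^ 2) = -c * ((n + 1) * t ^ 2) by ring]
            field_simp
          · refine Continuous.intervalIntegrable ?_ _ _
            simp only [hG]
            fun_prop
      _ = C * (1 + k ^ 2) * ((n + 1 : ℝ)⁻¹ * ∫ t in -L..L, G (√(n + 1) * t)) := by
          rw [intervalIntegral.integral_const_mul, intervalIntegral.integral_const_mul]
      _ ≤ C * (1 + k ^ 2) * ((n + 1 : ℝ)⁻¹ * ((√(n + 1))⁻¹ * ∫ s, G s)) := by
          gcongr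
          exact intervalIntegral_comp_sqrt_mul_le hGi hG0 hN hle
      _ = _ := by rw [mul_inv]; ring
  have hg := hgauss (n + 1) hN
  calc _ = ‖(∫ t in -L..L, (F t - b t ^ (n + 1) + H t))
        + (((∫ t in -L..L, Real.exp (-((n + 1) * v / 2) * t ^ 2))
          - √(2 * Real.pi / ((n + 1) * v)) : ℝ) : ℂ)‖ := by
        rw [hsplit, hbint]; push_cast; ring_nf
    _ ≤ C * (1 + k ^ 2) * (((n : ℝ) + 1) * √(n + 1))⁻¹ * (∫ s, G s)
        + C' * (((n : ℝ) + 1) * √(n + 1))⁻¹ := by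
        refine (norm_add_le _ _).trans (add_le_add hRint ?_)
        rwa [Complex.norm_real]
    _ ≤ C * (1 + k ^ 2) * (((n : ℝ) + 1) * √(n + 1))⁻¹ * (∫ s, G s)
        + C' * (1 + k ^ 2) * (((n : ℝ) + 1) * √(n + 1))⁻¹ := by
        gcongr
        exact le_mul_of_one_le_right hC' (by nlinarith [sq_nonneg k])
    _ = _ := by ring

/-! ### Characteristic functions: Taylor expansion and lattice rigidity -/

/-- Third order Taylor expansion of the characteristic function of a centered law. -/
lemma charFun_sub_taylor_isBigO {ν : Measure ℝ} [IsProbabilityMeasure ν] (h4 : MemLp id 4 ν)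
    (h0 : ∫ x, x ∂ν = 0) :
    ∃ g : ℂ, (fun t : ℝ => charFun ν t - (1 - (∫ x, x ^ 2 ∂ν : ℝ) * t ^ 2 / 2 + g * t ^ 3))
      =O[nhds 0] fun t => t ^ 4 := by
  have hlit := taylor_isLittleO_univ (x₀ := 0) (contDiff_charFun (n := 4) (μ := ν) (by exact_mod_cast h4))
  simp only [sub_zero] at hlit
  set q : ℂ := ((4 : ℕ).factorial : ℂ)⁻¹ * Complex.I ^ 4 * ((∫ x, x ^ 4 ∂ν : ℝ) : ℂ) with hq
  refine ⟨((3 : ℕ).factorial : ℂ)⁻¹ * Complex.I ^ 3 * ((∫ x, x ^ 3 ∂ν : ℝ) : ℂ), ?_⟩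
  have h5 : (fun t : ℝ => q * (t : ℂ) ^ 4) =O[nhds 0] fun t : ℝ => t ^ 4 := by
    refine IsBigO.of_bound ‖q‖ (Eventually.of_forall fun t => ?_)
    simp
  refine (hlit.isBigO.add h5).congr_left fun t => ?_
  rw [taylorWithinEval_charFun_zero (by exact_mod_cast h4)]
  simp only [Finset.sum_range_succ, Finset.range_zero, Finset.sum_empty, pow_zero, pow_one, h0,
    integral_const, probReal_univ, hq]
  simp only [mul_pow, Complex.I_sq]
  push_cast [Nat.factorial]
  simp
  ring

/-- If the characteristic function has modulus one at `t ≠ 0`, the law lives on a lattice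
of span `2π / |t|`. -/
lemma exists_onLattice_of_norm_charFun_eq_one {ν : Measure ℝ} [IsProbabilityMeasure ν] {t : ℝ}
    (ht : t ≠ 0) (h : ‖charFun ν t‖ = 1) : ∃ δ, OnLattice ν (2 * Real.pi / |t|) δ := by
  set θ := Complex.arg (charFun ν t) with hθ
  have hcf : charFun ν t = Complex.exp (θ * Complex.I) := by
    conv_lhs => rw [← Complex.norm_mul_exp_arg_mul_I (charFun ν t), h]
    simp [hθ]
  have hint : ∀ a b : ℝ, Integrable (fun x : ℝ => Complex.exp ((a * x + b : ℝ) * Complex.I)) ν := by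
    intro a b
    refine Integrable.of_bound (by fun_prop) 1 (ae_of_all _ fun x => ?_)
    rw [Complex.norm_exp_ofReal_mul_I]
  -- After rotation by e^{-iθ}, a mean of unit complex numbers equals 1. Hence the nonnegative
  -- function 1 − cos(tx − θ) has integral zero and vanishes almost everywhere.
  have hone : ∫ x : ℝ, Complex.exp ((t * x + -θ : ℝ) * Complex.I) ∂ν = 1 := by
    have : ∀ x : ℝ, Complex.exp ((t * x + -θ : ℝ) * Complex.I)
        = Complex.exp (-(θ * Complex.I)) * Complex.exp (t * x * Complex.I) := fun x => by
      rw [← Complex.exp_add]; congr 1; push_cast; ring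
    simp_rw [this]
    rw [integral_const_mul, ← charFun_apply_real, hcf, ← Complex.exp_add]
    simp
  have hcos : ∫ x : ℝ, (1 - Real.cos (t * x + -θ)) ∂ν = 0 := by
    have hre := congrArg Complex.re hone
    have hi := hint t (-θ)
    rw [show (∫ x : ℝ, Complex.exp ((t * x + -θ : ℝ) * Complex.I) ∂ν).re
      = ∫ x : ℝ, (Complex.exp ((t * x + -θ : ℝ) * Complex.I)).re ∂ν from
        (integral_re hi).symm] at hre
    simp_rw [Complex.exp_ofReal_mul_I_re] at hre
    rw [integral_sub (integrable_const _), hre]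
    · simp
    · exact hi.re.congr (ae_of_all _ fun x => Complex.exp_ofReal_mul_I_re _)
  have hae : (fun x : ℝ => 1 - Real.cos (t * x + -θ)) =ᵐ[ν] 0 := by
    refine (integral_eq_zero_iff_of_nonneg (fun x => ?_) ?_).1 hcos
    · simp [Real.cos_le_one]
    · refine Integrable.of_bound (by fun_prop) 2 (ae_of_all _ fun x => ?_)
      rw [Real.norm_eq_abs, abs_le]
      constructor <;> linarith [Real.cos_le_one (t * x + -θ), Real.neg_one_le_cos (t * x + -θ)]
  refine ⟨θ / t, ?_⟩
  filter_upwards [hae] with x hx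
  have hx' : Real.cos (t * x + -θ) = 1 := by
    simp only [Pi.zero_apply] at hx; linarith
  obtain ⟨k, hk⟩ := (Real.cos_eq_one_iff _).1 hx'
  have hxe : x = k * (2 * Real.pi / t) + θ / t := by
    field_simp
    linarith
  rcases lt_or_gt_of_ne ht with h1 | h1
  · refine ⟨-k, ?_⟩
    rw [abs_of_neg h1, hxe]
    push_cast
    rw [div_neg]; ring
  · exact ⟨k, by rw [abs_of_pos h1]; exact hxe⟩

/-! ### Fourier inversion, tilting and the Bahadur–Rao estimate for integer-valued sums -/

lemma integral_exp_int_mul_I (m : ℤ) :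
    ∫ t in -Real.pi..Real.pi, Complex.exp ((t * m : ℝ) * Complex.I)
      = if m = 0 then (2 * Real.pi : ℂ) else 0 := by
  split_ifs with hm
  · simp [hm]; ring
  · have hc : (m * Complex.I : ℂ) ≠ 0 := by simp [hm]
    have := integral_exp_mul_complex (a := -Real.pi) (b := Real.pi) hc
    rw [show (fun t : ℝ => Complex.exp ((t * m : ℝ) * Complex.I))
      = fun t : ℝ => Complex.exp (m * Complex.I * t) from by ext t; congr 1; push_cast; ring, this]
    have h2 : Complex.exp (m * Complex.I * Real.pi) = Complex.exp (m * Complex.I * (-Real.pi : ℝ)) := by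
      rw [Complex.exp_eq_exp_iff_exists_int]
      exact ⟨m, by push_cast; ring⟩
    rw [h2, sub_self, zero_div]

/-- Fourier inversion for an integer-valued random variable, with exponential weight. -/
lemma integral_laplace_mul_exp_eq {Ω : Type*} [MeasurableSpace Ω] {P : Measure Ω}
    [IsFiniteMeasure P] {T : Ω → ℝ} (hT : AEMeasurable T P) (hTint : ∀ᵐ ω ∂P, ∃ m : ℤ, T ω = m)
    {s : ℝ} (hs : Integrable (fun ω => Real.exp (s * T ω)) P) (k : ℤ) :
    ∫ t in -Real.pi..Real.pi, (∫ ω, Complex.exp ((s + t * Complex.I) * T ω) ∂P)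
        * Complex.exp ((-(k * t) : ℝ) * Complex.I)
      = 2 * Real.pi * Real.exp (s * k) * P.real {ω | T ω = k} := by
  have hmeas : AEStronglyMeasurable (Function.uncurry fun (t : ℝ) (ω : Ω) =>
      Complex.exp ((s + t * Complex.I) * T ω) * Complex.exp ((-(k * t) : ℝ) * Complex.I))
      ((volume.restrict (Set.uIoc (-Real.pi) Real.pi)).prod P) := by
    have h1 : AEMeasurable (fun p : ℝ × Ω => T p.2)
        ((volume.restrict (Set.uIoc (-Real.pi) Real.pi)).prod P) := hT.comp_snd
    have h2 : AEMeasurable (fun p : ℝ × Ω => p.1)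
        ((volume.restrict (Set.uIoc (-Real.pi) Real.pi)).prod P) := measurable_fst.aemeasurable
    refine AEMeasurable.aestronglyMeasurable ?_
    simp only [Function.uncurry_def]
    fun_prop
  have hint : Integrable (Function.uncurry fun (t : ℝ) (ω : Ω) =>
      Complex.exp ((s + t * Complex.I) * T ω) * Complex.exp ((-(k * t) : ℝ) * Complex.I))
      ((volume.restrict (Set.uIoc (-Real.pi) Real.pi)).prod P) := by
    have : IsFiniteMeasure (volume.restrict (Set.uIoc (-Real.pi) Real.pi)) :=
      ⟨by rw [Measure.restrict_apply_univ, Set.uIoc]; exact measure_Ioc_lt_top⟩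
    refine Integrable.mono' (hs.comp_snd _) hmeas (ae_of_all _ fun p => le_of_eq ?_)
    simp only [Function.uncurry_def]
    rw [norm_mul, Complex.norm_exp_ofReal_mul_I, mul_one, Complex.norm_exp]
    simp
  have hswap := intervalIntegral_integral_swap hint
  simp_rw [integral_mul_const] at hswap
  rw [hswap]
  have hnull : NullMeasurableSet {ω | T ω = k} P :=
    nullMeasurableSet_eq_fun hT aemeasurable_const
  have : ∀ᵐ ω ∂P, ∫ t in -Real.pi..Real.pi, Complex.exp ((s + t * Complex.I) * T ω)
        * Complex.exp ((-(k * t) : ℝ) * Complex.I)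
      = {ω | T ω = k}.indicator (fun _ => (2 * Real.pi * Real.exp (s * k) : ℂ)) ω := by
    filter_upwards [hTint] with ω ⟨m, hm⟩
    have h1 : ∀ t : ℝ, Complex.exp ((s + t * Complex.I) * T ω)
        * Complex.exp ((-(k * t) : ℝ) * Complex.I)
        = Real.exp (s * m) * Complex.exp ((t * (m - k : ℤ) : ℝ) * Complex.I) := fun t => by
      rw [← Complex.exp_add, Complex.ofReal_exp, ← Complex.exp_add, hm]
      congr 1; push_cast; ring
    simp_rw [h1]
    rw [intervalIntegral.integral_const_mul, integral_exp_int_mul_I]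
    by_cases hmk : m = k
    · simp [hm, hmk]; ring
    · have : m - k ≠ 0 := sub_ne_zero.2 hmk
      rw [if_neg this, Set.indicator_of_notMem, mul_zero]
      simpa [hm] using hmk
  rw [integral_congr_ae this, integral_indicator₀ hnull, setIntegral_const]
  simp
  ring

/-- This is where the change of measure enters: only the step law is tilted, and no tilted measure
on the probability space is needed. -/
lemma integral_cexp_eq_mgf_mul_charFun_tilted {ν : Measure ℝ} (s t : ℝ)
    (hs : 0 < ∫ y, Real.exp (s * y) ∂ν) :
    ∫ y : ℝ, Complex.exp ((s + t * Complex.I) * y) ∂ν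
      = (∫ y, Real.exp (s * y) ∂ν : ℝ) * charFun (ν.tilted fun y => s * y) t := by
  rw [charFun_apply_real, integral_tilted, ← integral_const_mul]
  refine integral_congr_ae (ae_of_all _ fun y => ?_)
  dsimp only
  rw [Complex.real_smul, ← mul_assoc, ← Complex.ofReal_mul, mul_div_cancel₀ _ hs.ne',
    Complex.ofReal_exp, ← Complex.exp_add]
  congr 1
  push_cast; ring

lemma integral_cexp_sum_eq_pow {Ω : Type*} [MeasurableSpace Ω] {P : Measure Ω}
    {Y : ℕ → Ω → ℝ} {ν : Measure ℝ} (hlaw : ∀ i, HasLaw (Y i) ν P) (hindep : iIndepFun Y P)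
    (z : ℂ) (n : ℕ) :
    ∫ ω, Complex.exp (z * (∑ i ∈ Finset.range n, Y i ω : ℝ)) ∂P
      = (∫ y : ℝ, Complex.exp (z * y) ∂ν) ^ n := by
  have hi : iIndepFun (fun i : Fin n => Y i) P := hindep.precomp Fin.val_injective
  have := iIndepFun.integral_fun_prod_comp (ι := Fin n) (𝓧 := fun _ => ℝ) (X := fun i => Y i)
    (f := fun _ (y : ℝ) => Complex.exp (z * y)) hi
    (fun i => (hlaw i).aemeasurable) (fun i => by fun_prop)
  simp_rw [← Complex.exp_sum, ← Finset.mul_sum] at this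
  have h2 : ∀ ω, ((∑ i ∈ Finset.range n, Y i ω : ℝ) : ℂ) = ∑ i : Fin n, (Y i ω : ℂ) := fun ω => by
    rw [Finset.sum_range]; push_cast; rfl
  simp_rw [h2, this]
  have h3 : ∀ i, ∫ ω, Complex.exp (z * Y i ω) ∂P = ∫ y : ℝ, Complex.exp (z * y) ∂ν := fun i =>
    (hlaw i).integral_comp (f := fun y : ℝ => Complex.exp (z * y)) (by fun_prop)
  simp [h3]

lemma summable_one_add_sq_mul_exp {s : ℝ} (hs : 0 < s) :
    Summable fun k : ℕ => (1 + (k : ℝ) ^ 2) * Real.exp (-s) ^ k := by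
  have h1 : ‖Real.exp (-s)‖ < 1 := by
    rw [Real.norm_of_nonneg (Real.exp_pos _).le]
    rw [← Real.exp_zero, Real.exp_lt_exp]; linarith
  have h2 := (summable_pow_mul_geometric_of_norm_lt_one 0 h1).add
    (summable_pow_mul_geometric_of_norm_lt_one 2 h1)
  refine h2.congr fun k => by ring

lemma hasSum_measureReal_eq_nat {Ω : Type*} [MeasurableSpace Ω] {P : Measure Ω}
    [IsFiniteMeasure P] {T : Ω → ℝ} (hT : AEMeasurable T P) (hTint : ∀ᵐ ω ∂P, ∃ m : ℤ, T ω = m) :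
    HasSum (fun k : ℕ => P.real {ω | T ω = k}) (P.real {ω | 0 ≤ T ω}) := by
  have h1 : {ω | 0 ≤ T ω} =ᵐ[P] ⋃ k : ℕ, {ω | T ω = k} := by
    filter_upwards [hTint] with ω ⟨m, hm⟩
    refine propext ⟨fun h => ?_, fun h => ?_⟩
    · have h0 : (0 : ℝ) ≤ T ω := h
      have : 0 ≤ m := by rw [hm] at h0; exact_mod_cast h0
      obtain ⟨j, rfl⟩ := Int.eq_ofNat_of_zero_le this
      exact Set.mem_iUnion.2 ⟨j, by simpa using hm⟩
    · obtain ⟨j, hj⟩ := Set.mem_iUnion.1 h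
      have hj' : T ω = j := hj
      change (0 : ℝ) ≤ T ω
      rw [hj']; positivity
  have h2 : P (⋃ k : ℕ, {ω | T ω = k}) = ∑' k : ℕ, P {ω | T ω = k} := by
    refine measure_iUnion₀ (fun i j hij => Disjoint.aedisjoint ?_) fun k =>
      nullMeasurableSet_eq_fun hT aemeasurable_const
    rw [Set.disjoint_left]
    intro ω hi hj
    have : (i : ℝ) = j := by rw [← (hi : T ω = i), ← (hj : T ω = j)]
    exact hij (by exact_mod_cast this)
  have h3 : ∑' k : ℕ, P {ω | T ω = k} ≠ ⊤ := by rw [← h2]; exact measure_ne_top _ _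
  have h4 := (ENNReal.hasSum_toReal h3)
  rw [measureReal_congr h1, measureReal_def, h2]
  rw [ENNReal.tsum_toReal_eq fun k => measure_ne_top _ _]
  exact h4

/-- Sharp lattice large deviation estimate (Bahadur–Rao) with relative error of order `1 / n`,
for integer-valued sums whose tilted step law is centered. -/
theorem abs_measureReal_sum_nonneg_sub_le {Ω : Type*} [MeasurableSpace Ω] {P : Measure Ω}
    [IsProbabilityMeasure P] {Y : ℕ → Ω → ℝ} {ν : Measure ℝ} (hlaw : ∀ i, HasLaw (Y i) ν P)
    (hindep : iIndepFun Y P) {s : ℝ} (hs : 0 < s)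
    (hint : Integrable (fun y => Real.exp (s * y)) ν)
    (h4 : MemLp id 4 (ν.tilted fun y => s * y)) (h0 : ∫ y, y ∂(ν.tilted fun y => s * y) = 0)
    (hv : 0 < ∫ y, y ^ 2 ∂(ν.tilted fun y => s * y))
    (hcf : ∀ t, 0 < |t| → |t| ≤ Real.pi → ‖charFun (ν.tilted fun y => s * y) t‖ < 1) :
    ∃ C, ∀ n : ℕ, 0 < n → (∀ᵐ ω ∂P, ∃ m : ℤ, ∑ i ∈ Finset.range n, Y i ω = m) →
      |P.real {ω | 0 ≤ ∑ i ∈ Finset.range n, Y i ω}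
        - (∫ y, Real.exp (s * y) ∂ν) ^ n * (1 - Real.exp (-s))⁻¹
          / √(2 * Real.pi * n * ∫ y, y ^ 2 ∂(ν.tilted fun y => s * y))|
      ≤ C * ((∫ y, Real.exp (s * y) ∂ν) ^ n / (n * √n)) := by
  have : IsProbabilityMeasure ν := (hlaw 0).isProbabilityMeasure_iff.1 inferInstance
  have : IsProbabilityMeasure (ν.tilted fun y => s * y) := isProbabilityMeasure_tilted hint
  set v := ∫ y, y ^ 2 ∂(ν.tilted fun y => s * y) with hvdef
  set ρ := ∫ y, Real.exp (s * y) ∂ν with hρdef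
  have hρ : 0 < ρ := integral_exp_pos hint
  set ψ := charFun (ν.tilted fun y => s * y) with hψ
  obtain ⟨g, hg⟩ := charFun_sub_taylor_isBigO h4 h0
  obtain ⟨C, hC, hmain⟩ := norm_integral_pow_mul_exp_sub_le continuous_charFun hv Real.pi_pos g hg hcf
  have hsum := (summable_one_add_sq_mul_exp hs).hasSum
  set M := ∑' k : ℕ, (1 + (k : ℝ) ^ 2) * Real.exp (-s) ^ k with hM
  refine ⟨C * M / (2 * Real.pi), fun n hn hTint => ?_⟩
  obtain ⟨n, rfl⟩ : ∃ j, n = j + 1 := ⟨n - 1, by omega⟩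
  set T : Ω → ℝ := fun ω => ∑ i ∈ Finset.range (n + 1), Y i ω with hT
  have hTm : AEMeasurable T P := by
    have := fun i => (hlaw i).aemeasurable
    fun_prop
  have hTi : Integrable (fun ω => Real.exp (s * T ω)) P := by
    -- A non-integrable function has integral 0 by convention, so positivity of the product of the
    -- moment generating functions already yields integrability.
    refine Integrable.of_integral_ne_zero ?_
    have h1 := hindep.mgf_sum₀ (t := s) (fun i => (hlaw i).aemeasurable) (Finset.range (n + 1))
    have h2 : ∀ i, mgf (Y i) P s = ρ := fun i =>
      (hlaw i).integral_comp (f := fun y => Real.exp (s * y)) (by fun_prop)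
    simp only [mgf, Finset.sum_apply] at h1 h2
    simp only [h2, Finset.prod_const, Finset.card_range] at h1
    rw [h1]
    positivity
  have hinv := integral_laplace_mul_exp_eq hTm hTint hTi
  -- Local limit estimate at the point k. The growth 1 + k² of its error is harmless against the
  -- weight e^{-sk}, so it can be summed over k.
  have hpk : ∀ k : ℕ, |P.real {ω | T ω = k}
      - ρ ^ (n + 1) * (√(2 * Real.pi / ((n + 1) * v)) / (2 * Real.pi)) * Real.exp (-s) ^ k|
      ≤ ρ ^ (n + 1) * (C * (((n : ℝ) + 1) * √(n + 1))⁻¹ / (2 * Real.pi)) *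
        ((1 + (k : ℝ) ^ 2) * Real.exp (-s) ^ k) := by
    intro k
    have h1 := hinv k
    have h2 : ∀ t : ℝ, ∫ ω, Complex.exp ((s + t * Complex.I) * T ω) ∂P
        = ρ ^ (n + 1) * ψ t ^ (n + 1) := fun t => by
      rw [hT, integral_cexp_sum_eq_pow hlaw hindep, integral_cexp_eq_mgf_mul_charFun_tilted _ _ hρ,
        mul_pow]
    simp_rw [h2, mul_assoc ((ρ : ℂ) ^ (n + 1))] at h1
    rw [intervalIntegral.integral_const_mul] at h1
    have h3 := hmain n k
    simp only [Int.cast_natCast] at h1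
    set J := ∫ t in -Real.pi..Real.pi, ψ t ^ (n + 1) * Complex.exp ((-(k * t) : ℝ) * Complex.I)
      with hJ
    set p := P.real {ω | T ω = k} with hp
    have h4 : p = ρ ^ (n + 1) / (2 * Real.pi) * Real.exp (-s) ^ k * J.re := by
      have h5 := congrArg Complex.re h1
      rw [← Complex.ofReal_pow, Complex.re_ofReal_mul] at h5
      rw [show (2 * Real.pi * Real.exp (s * k) * p : ℂ)
        = ((2 * Real.pi * Real.exp (s * k) * p : ℝ) : ℂ) by push_cast; rfl, Complex.ofReal_re] at h5
      rw [← Real.exp_nat_mul, mul_comm (k : ℝ), neg_mul, Real.exp_neg]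
      field_simp
      linarith
    have h6 : |J.re - √(2 * Real.pi / ((n + 1) * v))|
        ≤ C * (1 + (k : ℝ) ^ 2) * (((n : ℝ) + 1) * √(n + 1))⁻¹ := by
      refine le_trans ?_ h3
      have := Complex.abs_re_le_norm (J - (√(2 * Real.pi / ((n + 1) * v)) : ℝ))
      rwa [Complex.sub_re, Complex.ofReal_re] at this
    rw [h4, show ρ ^ (n + 1) / (2 * Real.pi) * Real.exp (-s) ^ k * J.re
      - ρ ^ (n + 1) * (√(2 * Real.pi / ((n + 1) * v)) / (2 * Real.pi)) * Real.exp (-s) ^ k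
      = ρ ^ (n + 1) / (2 * Real.pi) * Real.exp (-s) ^ k *
        (J.re - √(2 * Real.pi / ((n + 1) * v))) by ring, abs_mul, abs_of_pos (by positivity)]
    calc _ ≤ ρ ^ (n + 1) / (2 * Real.pi) * Real.exp (-s) ^ k *
        (C * (1 + (k : ℝ) ^ 2) * (((n : ℝ) + 1) * √(n + 1))⁻¹) := by gcongr
      _ = _ := by ring
  have hgeom : HasSum (fun k : ℕ => Real.exp (-s) ^ k) (1 - Real.exp (-s))⁻¹ :=
    hasSum_geometric_of_lt_one (Real.exp_pos _).le ((by rw [← Real.exp_zero, Real.exp_lt_exp]; linarith))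
  have hdiff := (hasSum_measureReal_eq_nat hTm hTint).sub
    (hgeom.mul_left (ρ ^ (n + 1) * (√(2 * Real.pi / ((n + 1) * v)) / (2 * Real.pi))))
  have hb := HasSum.norm_le_of_bounded hdiff (hsum.mul_left
    (ρ ^ (n + 1) * (C * (((n : ℝ) + 1) * √(n + 1))⁻¹ / (2 * Real.pi)))) hpk
  rw [Real.norm_eq_abs] at hb
  push_cast
  have hsq : √(2 * Real.pi / ((n + 1) * v)) / (2 * Real.pi)
      = 1 / √(2 * Real.pi * (n + 1) * v) := by
    rw [mul_assoc (2 * Real.pi), Real.sqrt_div (by positivity),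
      Real.sqrt_mul (x := 2 * Real.pi) (by positivity)]
    have : √(2 * Real.pi) ^ 2 = 2 * Real.pi := Real.sq_sqrt (by positivity)
    have h5 : √(2 * Real.pi) ≠ 0 := by positivity
    have h6 : √((n + 1) * v) ≠ 0 := by positivity
    rw [div_div, div_eq_div_iff (by positivity) (by positivity)]
    linear_combination √((n + 1) * v) * this
  rw [hsq] at hb
  refine le_trans (le_of_eq ?_) (hb.trans (le_of_eq ?_))
  · congr 2
    ring
  · ring

/-! ### The exponential family: mean parametrization, divergence and variance -/

/-- A point mass lies on lattices of every span, in particular 2d, against maximality of d. -/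
lemma IsLatticeOf.not_ae_eq_const {P₀ : Measure ℝ} {d δ : ℝ} (h : IsLatticeOf P₀ d δ) (m : ℝ) :
    ¬ ∀ᵐ x ∂P₀, x = m := by
  intro hm
  have := h.2.2 (2 * d) m (by linarith [h.1]) (hm.mono fun x hx => ⟨0, by simp [hx]⟩)
  linarith [h.1]

/-- Clearing the normalization and centring at m turns the mean condition into the vanishing of a
single integral against the fixed measure P₀, whose sign can be followed as β varies. -/
lemma hasMean_iff {P₀ : Measure ℝ} [IsProbabilityMeasure P₀] {β m : ℝ} :
    HasMean P₀ β m ↔ Integrable (fun x => Real.exp (β * x)) P₀ ∧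
      Integrable (fun x => (x - m) * Real.exp (β * x)) P₀ ∧
      ∫ x, (x - m) * Real.exp (β * x) ∂P₀ = 0 := by
  unfold HasMean expFamily
  refine and_congr_right fun h => ?_
  have hZ : 0 < ∫ x, Real.exp (β * x) ∂P₀ := integral_exp_pos h
  rw [integrable_tilted_iff h]
  simp only [smul_eq_mul]
  have hiff : Integrable (fun x => Real.exp (β * x) * x) P₀ ↔
      Integrable (fun x => (x - m) * Real.exp (β * x)) P₀ := by
    refine ⟨fun hi => (hi.sub (h.const_mul m)).congr (ae_of_all _ fun x => ?_),
      fun hi => (hi.add (h.const_mul m)).congr (ae_of_all _ fun x => ?_)⟩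
    · simp only [Pi.sub_apply]; ring
    · simp only [Pi.add_apply]; ring
  rw [hiff]
  refine and_congr_right fun hi => ?_
  rw [integral_tilted]
  have h1 : ∫ x, (Real.exp (β * x) / ∫ x, Real.exp (β * x) ∂P₀) • x ∂P₀
      = (∫ x, (x - m) * Real.exp (β * x) ∂P₀) / (∫ x, Real.exp (β * x) ∂P₀) + m := by
    have h2 : ∫ x, Real.exp (β * x) * x ∂P₀
        = (∫ x, (x - m) * Real.exp (β * x) ∂P₀) + m * ∫ x, Real.exp (β * x) ∂P₀ := by
      rw [← integral_const_mul, ← integral_add hi (h.const_mul m)]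
      exact integral_congr_ae (ae_of_all _ fun x => by ring)
    simp_rw [smul_eq_mul, div_mul_eq_mul_div]
    rw [integral_div, h2, add_div, mul_div_cancel_right₀ _ hZ.ne']
  rw [h1, add_eq_right, div_eq_zero_iff]
  simp [hZ.ne']

lemma sub_mul_exp_sub_exp_nonneg {a : ℝ} (ha : 0 ≤ a) (x m : ℝ) :
    0 ≤ (x - m) * (Real.exp (a * x) - Real.exp (a * m)) := by
  rcases le_total x m with h | h
  · exact mul_nonneg_of_nonpos_of_nonpos (by linarith)
      (sub_nonpos.2 (Real.exp_le_exp.2 (mul_le_mul_of_nonneg_left h ha)))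
  · exact mul_nonneg (by linarith)
      (sub_nonneg.2 (Real.exp_le_exp.2 (mul_le_mul_of_nonneg_left h ha)))

/-- If β < β', subtracting e^{(β'-β)m} times the centred integral at β from that at β' leaves a
nonnegative integrand that vanishes only at x = m. Both integrals being zero would force a point
mass. -/
lemma HasMean.le_of_hasMean {P₀ : Measure ℝ} [IsProbabilityMeasure P₀] {m β β' : ℝ}
    (hnd : ¬ ∀ᵐ x ∂P₀, x = m) (h : HasMean P₀ β m) (h' : HasMean P₀ β' m) : β' ≤ β := by
  by_contra! hlt
  obtain ⟨-, h1, h2⟩ := hasMean_iff.1 h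
  obtain ⟨-, h1', h2'⟩ := hasMean_iff.1 h'
  set c := Real.exp ((β' - β) * m)
  have hform : ∀ x : ℝ, (x - m) * Real.exp (β' * x) - c * ((x - m) * Real.exp (β * x))
      = Real.exp (β * x) * ((x - m) * (Real.exp ((β' - β) * x) - c)) := fun x => by
    rw [show β' * x = β * x + (β' - β) * x by ring, Real.exp_add]; ring
  have h0 : ∫ x, ((x - m) * Real.exp (β' * x) - c * ((x - m) * Real.exp (β * x))) ∂P₀ = 0 := by
    rw [integral_sub h1' (h1.const_mul c), integral_const_mul, h2, h2']; ring
  have hae := (integral_eq_zero_iff_of_nonneg (fun x => (mul_nonneg (Real.exp_pos (β * x)).le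
    (sub_mul_exp_sub_exp_nonneg (sub_nonneg.2 hlt.le) x m)).trans_eq (hform x).symm)
    (h1'.sub (h1.const_mul c))).1 h0
  refine hnd (hae.mono fun x hx => ?_)
  have hx' : Real.exp (β * x) * ((x - m) * (Real.exp ((β' - β) * x) - c)) = 0 := by
    rw [← hform]; exact hx
  rcases mul_eq_zero.1 hx' with h3 | h3
  · exact absurd h3 (Real.exp_pos _).ne'
  rcases mul_eq_zero.1 h3 with h4 | h4
  · linarith
  · have := Real.exp_injective (sub_eq_zero.1 h4)
    exact mul_left_cancel₀ (by linarith : β' - β ≠ 0) this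

/-- `mle` is defined by choice; uniqueness of β makes the choice immaterial. -/
lemma HasMean.mle_eq {P₀ : Measure ℝ} [IsProbabilityMeasure P₀] {m β : ℝ}
    (hnd : ¬ ∀ᵐ x ∂P₀, x = m) (h : HasMean P₀ β m) : mle P₀ m = β := by
  have hex : ∃ β, HasMean P₀ β m := ⟨β, h⟩
  have h' : HasMean P₀ (mle P₀ m) m := by
    unfold mle; rw [dif_pos hex]; exact hex.choose_spec
  exact le_antisymm (h.le_of_hasMean hnd h') (h'.le_of_hasMean hnd h)

lemma hasMean_deriv_cgf {P₀ : Measure ℝ} {β : ℝ}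
    (hβ : β ∈ interior (integrableExpSet id P₀)) : HasMean P₀ β (deriv (cgf id P₀) β) := by
  refine ⟨integrable_of_mem_integrableExpSet (interior_subset hβ), ?_, integral_tilted_mul_self hβ⟩
  have h := memLp_tilted_mul hβ 1
  exact memLp_one_iff_integrable.1 (by exact_mod_cast h)

/-- Every value strictly between the mean of `P₀` and `sup M` is the mean of some `P_β`, `β > 0`
an interior point of the domain of the moment generating function. -/
lemma exists_hasMean_of_lt_muStar {P₀ : Measure ℝ} [IsProbabilityMeasure P₀] {μ : ℝ}
    (hint : Integrable (fun x => x) P₀)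
    (hμ₀ : ∫ x, x ∂P₀ < μ) (hμ : (μ : EReal) < muStar P₀) :
    ∃ β, 0 < β ∧ HasMean P₀ β μ ∧ β ∈ interior (integrableExpSet id P₀) := by
  -- Some attained mean m, at parameter β₁, exceeds μ. The integral of (x − μ)e^{βx} is negative at
  -- β = 0 and positive at β₁, so the intermediate value theorem applies.
  obtain ⟨_, ⟨m, ⟨β₁, hm⟩, rfl⟩, hlt⟩ := lt_sSup_iff.1 hμ
  have hμm : μ < m := EReal.coe_lt_coe_iff.1 hlt
  obtain ⟨hZ, hi, hzero⟩ := hasMean_iff.1 hm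
  have hi' : Integrable (fun x => (x - μ) * Real.exp (β₁ * x)) P₀ :=
    (hi.add (hZ.const_mul (m - μ))).congr (ae_of_all _ fun x => by simp only [Pi.add_apply]; ring)
  have hpos : 0 < ∫ x, (x - μ) * Real.exp (β₁ * x) ∂P₀ := by
    have : ∫ x, (x - μ) * Real.exp (β₁ * x) ∂P₀
        = (∫ x, (x - m) * Real.exp (β₁ * x) ∂P₀) + (m - μ) * ∫ x, Real.exp (β₁ * x) ∂P₀ := by
      rw [← integral_const_mul, ← integral_add hi (hZ.const_mul _)]
      exact integral_congr_ae (ae_of_all _ fun x => by ring)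
    rw [this, hzero, zero_add]
    exact mul_pos (by linarith) (integral_exp_pos hZ)
  have hisub : Integrable (fun x => x - μ) P₀ := hint.sub (integrable_const _)
  have hneg : ∫ x, (x - μ) ∂P₀ < 0 := by
    rw [integral_sub hint (integrable_const _)]; simp; linarith
  have hβ₁ : 0 < β₁ := by
    by_contra hβ
    have hle : ∫ x, (x - μ) * Real.exp (β₁ * x) ∂P₀ ≤ ∫ x, Real.exp (β₁ * μ) * (x - μ) ∂P₀ := by
      refine integral_mono hi' (hisub.const_mul _) fun x => ?_
      -- For β₁ ≤ 0 the weight is decreasing; reflecting x, μ and β₁ reduces to the increasing case.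
      have := sub_mul_exp_sub_exp_nonneg (a := -β₁) (by linarith) (-x) (-μ)
      rw [neg_mul_neg, neg_mul_neg] at this
      dsimp only
      linarith
    rw [integral_const_mul] at hle
    nlinarith [mul_neg_of_pos_of_neg (Real.exp_pos (β₁ * μ)) hneg]
  set G : ℝ → ℝ := fun β => ∫ x, (x - μ) * Real.exp (β * x) ∂P₀ with hG
  have hbd : Integrable (fun x => |x - μ| + |(x - μ) * Real.exp (β₁ * x)|) P₀ :=
    hisub.abs.add hi'.abs
  have hbound : ∀ β ∈ Set.Icc 0 β₁, ∀ x : ℝ, ‖(x - μ) * Real.exp (β * x)‖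
      ≤ |x - μ| + |(x - μ) * Real.exp (β₁ * x)| := by
    intro β hβ x
    rw [Real.norm_eq_abs, abs_mul, abs_mul, Real.abs_exp, Real.abs_exp]
    have : Real.exp (β * x) ≤ 1 + Real.exp (β₁ * x) := by
      rcases le_total x 0 with h | h
      · have := Real.exp_le_one_iff.2 (mul_nonpos_of_nonneg_of_nonpos hβ.1 h)
        linarith [Real.exp_pos (β₁ * x)]
      · have := Real.exp_le_exp.2 (mul_le_mul_of_nonneg_right hβ.2 h)
        linarith
    nlinarith [abs_nonneg (x - μ)]
  have hcont : ContinuousOn G (Set.Icc 0 β₁) := by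
    refine continuousOn_of_dominated (bound := fun x => |x - μ| + |(x - μ) * Real.exp (β₁ * x)|)
      (fun β _ => by fun_prop) (fun β hβ => ae_of_all _ (hbound β hβ)) hbd
      (ae_of_all _ fun x => by fun_prop)
  have hG0 : G 0 < 0 := by simpa [hG] using hneg
  obtain ⟨β, hβ, hβ0⟩ := intermediate_value_Icc hβ₁.le hcont ⟨hG0.le, hpos.le⟩
  -- The strict signs at both ends keep β off the endpoints, so β is interior to the domain even if
  -- β₁ lies on its boundary.
  have hne0 : 0 < β := lt_of_le_of_ne hβ.1 (by rintro rfl; exact hG0.ne hβ0)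
  have hne1 : β < β₁ := lt_of_le_of_ne hβ.2 (by rintro rfl; exact hpos.ne' hβ0)
  have hsub : Set.Icc 0 β₁ ⊆ integrableExpSet id P₀ :=
    (convex_integrableExpSet.ordConnected).out (by simp [integrableExpSet]) hZ
  have hint' : β ∈ interior (integrableExpSet id P₀) :=
    interior_mono hsub (by rw [interior_Icc]; exact ⟨hne0, hne1⟩)
  refine ⟨β, hne0, hasMean_iff.2 ⟨integrable_of_mem_integrableExpSet (interior_subset hint'), ?_, hβ0⟩, hint'⟩
  exact hbd.mono' (by fun_prop) (ae_of_all _ (hbound β hβ))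

/-- Convexity of the cumulant generating function, in the form of a supporting line. -/
lemma HasMean.cgf_add_le {P₀ : Measure ℝ} [IsProbabilityMeasure P₀] {β β' m : ℝ}
    (h : HasMean P₀ β m) (h' : Integrable (fun x => Real.exp (β' * x)) P₀) :
    cgf id P₀ β + (β' - β) * m ≤ cgf id P₀ β' := by
  obtain ⟨hZ, hi, hzero⟩ := hasMean_iff.1 h
  have hZpos : 0 < ∫ x, Real.exp (β * x) ∂P₀ := integral_exp_pos hZ
  have key : Real.exp ((β' - β) * m) * ∫ x, Real.exp (β * x) ∂P₀
      ≤ ∫ x, Real.exp (β' * x) ∂P₀ := by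
    have h1 : ∫ x, Real.exp ((β' - β) * m) * (Real.exp (β * x)
          + (β' - β) * ((x - m) * Real.exp (β * x))) ∂P₀
        = Real.exp ((β' - β) * m) * ∫ x, Real.exp (β * x) ∂P₀ := by
      rw [integral_const_mul, integral_add hZ (hi.const_mul _), integral_const_mul, hzero]
      ring
    rw [← h1]
    refine integral_mono ((hZ.add (hi.const_mul _)).const_mul _) h' fun x => ?_
    dsimp only
    have h2 := Real.add_one_le_exp ((β' - β) * (x - m))
    calc _ = Real.exp ((β' - β) * m) * Real.exp (β * x) * ((β' - β) * (x - m) + 1) := by ring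
      _ ≤ Real.exp ((β' - β) * m) * Real.exp (β * x) * Real.exp ((β' - β) * (x - m)) := by
          gcongr
      _ = Real.exp (β' * x) := by
          rw [← Real.exp_add, ← Real.exp_add]; congr 1; ring
  have h3 := Real.log_le_log (by positivity) key
  rw [Real.log_mul (Real.exp_pos _).ne' hZpos.ne', Real.log_exp] at h3
  simp only [cgf, mgf, id]
  linarith

lemma llr_expFamily_ae_eq {P₀ : Measure ℝ} [IsProbabilityMeasure P₀] {β : ℝ}
    (h : Integrable (fun x => Real.exp (β * x)) P₀) :
    llr (expFamily P₀ β) P₀ =ᵐ[expFamily P₀ β] fun x => β * x - cgf id P₀ β :=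
  (tilted_absolutelyContinuous P₀ _).ae_le (log_rnDeriv_tilted_left_self h)

lemma HasMean.klDiv_ne_top {P₀ : Measure ℝ} [IsProbabilityMeasure P₀] {β m : ℝ}
    (h : HasMean P₀ β m) : InformationTheory.klDiv (expFamily P₀ β) P₀ ≠ ⊤ := by
  have : IsProbabilityMeasure (expFamily P₀ β) := isProbabilityMeasure_tilted h.1
  refine InformationTheory.klDiv_ne_top (tilted_absolutelyContinuous P₀ _) ?_
  exact (((h.2.1.const_mul β).sub (integrable_const _)).congr (llr_expFamily_ae_eq h.1).symm)

lemma HasMean.toReal_klDiv {P₀ : Measure ℝ} [IsProbabilityMeasure P₀] {β m : ℝ}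
    (h : HasMean P₀ β m) :
    (InformationTheory.klDiv (expFamily P₀ β) P₀).toReal = β * m - cgf id P₀ β := by
  have : IsProbabilityMeasure (expFamily P₀ β) := isProbabilityMeasure_tilted h.1
  rw [InformationTheory.toReal_klDiv_of_measure_eq 
      (show expFamily P₀ β ≪ P₀ from tilted_absolutelyContinuous P₀ _) (by simp),
    integral_congr_ae (llr_expFamily_ae_eq h.1),
    integral_sub (h.2.1.const_mul β) (integrable_const _), integral_const_mul, h.2.2]
  simp

lemma HasMean.divFun_eq {P₀ : Measure ℝ} [IsProbabilityMeasure P₀] {β m : ℝ}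
    (hnd : ¬ ∀ᵐ x ∂P₀, x = m) (h : HasMean P₀ β m) :
    divFun P₀ m = β * m - cgf id P₀ β := by
  rw [divFun, withMean, h.mle_eq hnd, h.toReal_klDiv]

/-- Zero divergence would identify the tilted law with P₀ and hence their means. -/
lemma HasMean.divFun_pos {P₀ : Measure ℝ} [IsProbabilityMeasure P₀] {β m : ℝ}
    (hnd : ¬ ∀ᵐ x ∂P₀, x = m) (h : HasMean P₀ β m) (hm : ∫ x, x ∂P₀ ≠ m) :
    0 < divFun P₀ m := by
  have : IsProbabilityMeasure (expFamily P₀ β) := isProbabilityMeasure_tilted h.1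
  rw [divFun, withMean, h.mle_eq hnd]
  refine ENNReal.toReal_pos (fun h0 => hm ?_) h.klDiv_ne_top
  rw [InformationTheory.klDiv_eq_zero_iff] at h0
  rw [← h.2.2, h0]

lemma integral_sq_sub_tilted_pos {P₀ : Measure ℝ} {β : ℝ} (m : ℝ)
    (hnd : ¬ ∀ᵐ x ∂P₀, x = m) (hβ : β ∈ interior (integrableExpSet id P₀)) :
    0 < ∫ x, (x - m) ^ 2 ∂(expFamily P₀ β) := by
  have h2 : MemLp (fun x : ℝ => x) 2 (expFamily P₀ β) := by
    exact_mod_cast memLp_tilted_mul hβ 2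
  have : IsFiniteMeasure (expFamily P₀ β) := by unfold expFamily; infer_instance
  have hi : Integrable (fun x : ℝ => (x - m) ^ 2) (expFamily P₀ β) :=
    (h2.sub (memLp_const m)).integrable_sq
  refine lt_of_le_of_ne (integral_nonneg fun x => sq_nonneg _) fun h0 => hnd ?_
  have h3 := (integral_eq_zero_iff_of_nonneg (fun x => sq_nonneg _) hi).1 h0.symm
  have h4 := (absolutelyContinuous_tilted
    (integrable_of_mem_integrableExpSet (interior_subset hβ))).ae_le h3
  filter_upwards [h4] with x hx
  have : (x - m) ^ 2 = 0 := hx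
  linarith [pow_eq_zero_iff (two_ne_zero) |>.1 this]

lemma HasMean.varFun_eq {P₀ : Measure ℝ} [IsProbabilityMeasure P₀] {β m : ℝ}
    (hnd : ¬ ∀ᵐ x ∂P₀, x = m) (h : HasMean P₀ β m) :
    varFun P₀ m = ∫ x, (x - m) ^ 2 ∂(expFamily P₀ β) := by
  rw [varFun, withMean, h.mle_eq hnd, variance_eq_integral (by fun_prop), h.2.2]

/-- Second-order expansion of the information divergence. -/
lemma divFun_sub_sub_isBigO {P₀ : Measure ℝ} [IsProbabilityMeasure P₀] {β μ : ℝ}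
    (hnd : ∀ m, ¬ ∀ᵐ x ∂P₀, x = m) (h : HasMean P₀ β μ)
    (hβ : β ∈ interior (integrableExpSet id P₀)) :
    (fun m => divFun P₀ m - divFun P₀ μ - β * (m - μ)) =O[nhds μ] fun m => (m - μ) ^ 2 := by
  have hμ : deriv (cgf id P₀) β = μ := by
    rw [← h.2.2]; exact (integral_tilted_mul_self hβ).symm
  have hd : deriv (deriv (cgf id P₀)) β ≠ 0 := by
    rw [show deriv (deriv (cgf id P₀)) β = iteratedDeriv 2 (cgf id P₀) β by
      rw [iteratedDeriv_succ, iteratedDeriv_one], ← variance_tilted_mul hβ]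
    have := integral_sq_sub_tilted_pos μ (hnd μ) hβ
    rw [← h.varFun_eq (hnd μ), varFun, withMean, h.mle_eq (hnd μ)] at this
    exact this.ne'
  have hs : HasStrictDerivAt (deriv (cgf id P₀)) (deriv (deriv (cgf id P₀)) β) β :=
    (analyticAt_cgf hβ).deriv.hasStrictDerivAt
  -- The derivative of the cumulant generating function sends a parameter to its mean and has the
  -- nonzero variance as its own derivative, so the inverse function theorem provides ζ, which is β̂
  -- near μ.
  obtain ⟨ζ, hinv, hζμ, hright⟩ : ∃ ζ : ℝ → ℝ, DifferentiableAt ℝ ζ μ ∧ ζ μ = β ∧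
      ∀ᶠ m in nhds μ, deriv (cgf id P₀) (ζ m) = m := by
    have hf := hs.hasStrictFDerivAt_equiv hd
    refine ⟨hf.localInverse _ _ _, ?_, ?_, ?_⟩
    · exact hμ ▸ hf.to_localInverse.differentiableAt
    · exact hμ ▸ hf.localInverse_apply_image
    · exact hμ ▸ hf.eventually_right_inverse
  have hmem : ∀ᶠ m in nhds μ, ζ m ∈ interior (integrableExpSet id P₀) := by
    exact hinv.continuousAt.eventually_mem (by rw [hζμ]; exact isOpen_interior.mem_nhds hβ)
  have hlip : (fun m => ζ m - β) =O[nhds μ] fun m => m - μ := by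
    have := hinv.isBigO_sub
    rwa [hζμ] at this
  have hprod : (fun m => (ζ m - β) * (m - μ)) =O[nhds μ] fun m => (m - μ) ^ 2 :=
    (hlip.mul (isBigO_refl _ _)).congr_right fun m => by ring
  -- The supporting lines of the cumulant generating function at β and at ζ m trap the remainder
  -- between 0 and (ζ m − β)(m − μ).
  refine IsBigO.trans (IsBigO.of_bound 1 ?_) hprod
  filter_upwards [hright, hmem] with m hm hmm
  have hζm : HasMean P₀ (ζ m) m := by
    have := hasMean_deriv_cgf hmm
    rwa [hm] at this
  have h1 := h.cgf_add_le hζm.1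
  have h2 := hζm.cgf_add_le h.1
  rw [h.divFun_eq (hnd μ), hζm.divFun_eq (hnd m), one_mul, Real.norm_eq_abs, Real.norm_eq_abs,
    abs_of_nonneg (by nlinarith)]
  refine le_trans ?_ (le_abs_self _)
  nlinarith

/-! ### The Gaussian tail -/

lemma stdGaussianCDF_neg (x : ℝ) :
    stdGaussianCDF (-x) = (√(2 * Real.pi))⁻¹ * ∫ u in Set.Ioi x, Real.exp (-(u ^ 2 / 2)) := by
  rw [stdGaussianCDF, cdf_eq_real, measureReal_def,
    gaussianReal_apply_eq_integral 0 one_ne_zero, ENNReal.toReal_ofReal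
      (setIntegral_nonneg measurableSet_Iic fun u _ => gaussianPDFReal_nonneg _ _ _)]
  have h := integral_comp_neg_Iic (-x) (fun u => gaussianPDFReal 0 1 u)
  rw [neg_neg] at h
  have h2 : ∀ u, gaussianPDFReal 0 1 (-u) = gaussianPDFReal 0 1 u := fun u => by
    simp [gaussianPDFReal]
  simp_rw [h2] at h
  rw [h, ← integral_const_mul]
  refine setIntegral_congr_fun measurableSet_Ioi fun u _ => ?_
  simp [gaussianPDFReal, neg_div]

/-- Mills ratio bounds. -/
lemma integral_Ioi_exp_neg_sq_bounds {x : ℝ} (hx : 0 < x) :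
    (∫ u in Set.Ioi x, Real.exp (-(u ^ 2 / 2))) ≤ Real.exp (-(x ^ 2 / 2)) / x ∧
    Real.exp (-(x ^ 2 / 2)) / x
      ≤ (1 + 1 / x ^ 2) * ∫ u in Set.Ioi x, Real.exp (-(u ^ 2 / 2)) := by
  -- With the factor 1 + 1/u² the integrand has an explicit primitive and its tail integral is
  -- exactly e^{-x²/2}/x; both bounds follow from 1 ≤ 1 + 1/u² ≤ 1 + 1/x².
  have hd : ∀ u ∈ Set.Ici x, HasDerivAt (fun u => -(Real.exp (-(u ^ 2 / 2)) / u))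
      (Real.exp (-(u ^ 2 / 2)) * (1 + 1 / u ^ 2)) u := fun u hu => by
    have hu0 : u ≠ 0 := (hx.trans_le hu).ne'
    have h1 : HasDerivAt (fun u : ℝ => -(u ^ 2 / 2)) (-u) u := by
      have := ((hasDerivAt_pow 2 u).div_const 2).neg
      convert! this using 1
      simp
    have h2 := (h1.exp.div (hasDerivAt_id u) hu0).neg
    convert! h2 using 1
    simp only [id]
    field_simp
    ring
  have hi : IntegrableOn (fun u : ℝ => Real.exp (-(u ^ 2 / 2))) (Set.Ioi x) := by
    have := (integrable_exp_neg_mul_sq (b := 1 / 2) (by norm_num)).integrableOn (s := Set.Ioi x)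
    refine this.congr_fun (fun u _ => ?_) measurableSet_Ioi
    dsimp only; congr 1; ring
  have hi' : IntegrableOn (fun u : ℝ => Real.exp (-(u ^ 2 / 2)) * (1 + 1 / u ^ 2)) (Set.Ioi x) := by
    refine Integrable.mono' (hi.mul_const (1 + 1 / x ^ 2)) (by fun_prop) ?_
    filter_upwards [ae_restrict_mem measurableSet_Ioi] with u hu
    have : x < u := hu
    rw [Real.norm_of_nonneg (by positivity)]
    gcongr
  have hlim : Tendsto (fun u : ℝ => -(Real.exp (-(u ^ 2 / 2)) / u)) atTop (nhds 0) := by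
    have h1 : Tendsto (fun u : ℝ => u⁻¹) atTop (nhds 0) := tendsto_inv_atTop_zero
    have h2 : Tendsto (fun u : ℝ => -u⁻¹) atTop (nhds 0) := by simpa using h1.neg
    refine tendsto_of_tendsto_of_tendsto_of_le_of_le' h2 tendsto_const_nhds ?_ ?_
    · filter_upwards [eventually_gt_atTop 0] with u hu
      rw [neg_le_neg_iff, div_eq_mul_inv]
      exact mul_le_of_le_one_left (by positivity)
        (Real.exp_le_one_iff.2 (neg_nonpos.2 (by positivity)))
    · filter_upwards [eventually_gt_atTop 0] with u hu
      rw [neg_nonpos]; positivity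
  have hval := integral_Ioi_of_hasDerivAt_of_tendsto
    (hd x Set.self_mem_Ici).continuousAt.continuousWithinAt
    (fun u hu => hd u (Set.Ioi_subset_Ici_self hu)) hi' hlim
  rw [zero_sub, neg_neg] at hval
  rw [← hval]
  constructor
  · refine setIntegral_mono_on hi hi' measurableSet_Ioi fun u hu => ?_
    have : 0 ≤ 1 / u ^ 2 := by positivity
    nlinarith [Real.exp_pos (-(u ^ 2 / 2))]
  · rw [mul_comm, ← integral_mul_const]
    refine setIntegral_mono_on hi' (hi.mul_const _) measurableSet_Ioi fun u hu => ?_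
    have : x < u := hu
    gcongr

/-- Relative accuracy of the leading term of the Gaussian tail. -/
lemma abs_stdGaussianCDF_neg_div_sub_one_le {x : ℝ} (hx : 0 < x) :
    |stdGaussianCDF (-x) / (Real.exp (-(x ^ 2 / 2)) / (√(2 * Real.pi) * x)) - 1| ≤ 1 / x ^ 2 := by
  obtain ⟨h1, h2⟩ := integral_Ioi_exp_neg_sq_bounds hx
  rw [stdGaussianCDF_neg]
  set I := ∫ u in Set.Ioi x, Real.exp (-(u ^ 2 / 2))
  have h0 : 0 < Real.exp (-(x ^ 2 / 2)) / x := by positivity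
  set E := Real.exp (-(x ^ 2 / 2)) / x with hE
  have hre : (√(2 * Real.pi))⁻¹ * I / (Real.exp (-(x ^ 2 / 2)) / (√(2 * Real.pi) * x)) = I / E := by
    rw [hE]; field_simp
  have hle : I / E ≤ 1 := (div_le_one h0).2 h1
  have hge : 1 - 1 / x ^ 2 ≤ I / E := by
    have h3 : 1 ≤ (1 + 1 / x ^ 2) * (I / E) := by
      rw [← mul_div_assoc, one_le_div h0]; exact h2
    have : 0 ≤ 1 / x ^ 2 := by positivity
    nlinarith
  rw [hre, abs_sub_comm, abs_of_nonneg (by linarith)]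
  linarith

/-! ### Calculus of relative errors O(1/n) -/

lemma tendsto_of_sub_isBigO_one_div {f : ℕ → ℝ} {a : ℝ}
    (hf : (fun n => f n - a) =O[atTop] fun n : ℕ => 1 / (n : ℝ)) : Tendsto f atTop (nhds a) := by
  have := (hf.trans_tendsto tendsto_one_div_atTop_nhds_zero_nat).add_const a
  simpa using this

lemma comp_sub_isBigO_one_div {f : ℕ → ℝ} {a φ' : ℝ} {φ : ℝ → ℝ} (hφ : HasDerivAt φ φ' a)
    (hf : (fun n => f n - a) =O[atTop] fun n : ℕ => 1 / (n : ℝ)) :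
    (fun n => φ (f n) - φ a) =O[atTop] fun n : ℕ => 1 / (n : ℝ) :=
  (hφ.isBigO_sub.comp_tendsto (tendsto_of_sub_isBigO_one_div hf)).trans hf

lemma mul_sub_one_isBigO_one_div {f g : ℕ → ℝ}
    (hf : (fun n => f n - 1) =O[atTop] fun n : ℕ => 1 / (n : ℝ))
    (hg : (fun n => g n - 1) =O[atTop] fun n : ℕ => 1 / (n : ℝ)) :
    (fun n => f n * g n - 1) =O[atTop] fun n : ℕ => 1 / (n : ℝ) := by
  have h1 : (fun n => (f n - 1) * g n) =O[atTop] fun n : ℕ => 1 / (n : ℝ) := by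
    simpa using hf.mul ((tendsto_of_sub_isBigO_one_div hg).isBigO_one ℝ)
  exact (h1.add hg).congr_left fun n => by ring

/-! ### Standardization and the two leading terms -/

/-- The tilted law of the standardized variable is the image of the tilted law. -/
lemma tilted_map_sub_div {P₀ : Measure ℝ} {β μ d : ℝ} (hd : d ≠ 0) :
    (P₀.map fun x => (x - μ) / d).tilted (fun y => d * β * y)
      = (expFamily P₀ β).map fun x => (x - μ) / d := by
  have hm : Measurable fun x : ℝ => (x - μ) / d := by fun_prop
  ext s hs
  rw [tilted_apply' _ _ hs, Measure.map_apply hm hs, expFamily, tilted_apply' _ _ (hm hs),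
    setLIntegral_map hs (by fun_prop) hm,
    integral_map hm.aemeasurable (by fun_prop)]
  have h : ∀ x : ℝ, Real.exp (d * β * ((x - μ) / d))
      = Real.exp (-(β * μ)) * Real.exp (β * x) := fun x => by
    rw [← Real.exp_add]; congr 1; field_simp; ring
  simp_rw [h]
  rw [integral_const_mul]
  simp_rw [mul_div_mul_left _ _ (Real.exp_pos (-(β * μ))).ne']

/-- Modulus one at t would put the standardized law on a lattice of span 2π/|t| ≥ 2. Tilting
preserves null sets, so P₀ would live on a lattice of span at least 2d. -/
lemma norm_charFun_map_expFamily_lt_one {P₀ : Measure ℝ} [IsProbabilityMeasure P₀] {β μ d δ : ℝ}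
    (hint : Integrable (fun x => Real.exp (β * x)) P₀) (hlat : IsLatticeOf P₀ d δ)
    {t : ℝ} (ht : 0 < |t|) (htπ : |t| ≤ Real.pi) :
    ‖charFun ((expFamily P₀ β).map fun x => (x - μ) / d) t‖ < 1 := by
  have : IsProbabilityMeasure (expFamily P₀ β) := isProbabilityMeasure_tilted hint
  have hm : Measurable fun x : ℝ => (x - μ) / d := by fun_prop
  have : IsProbabilityMeasure ((expFamily P₀ β).map fun x => (x - μ) / d) :=
    Measure.isProbabilityMeasure_map hm.aemeasurable
  refine lt_of_le_of_ne (norm_charFun_le_one t) fun h => ?_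
  obtain ⟨δ', hδ'⟩ := exists_onLattice_of_norm_charFun_eq_one (abs_pos.1 ht) h
  have hd := hlat.1
  have h1 : OnLattice P₀ (2 * Real.pi / |t| * d) (d * δ' + μ) := by
    have h2 := (absolutelyContinuous_tilted hint).ae_le (ae_of_ae_map hm.aemeasurable hδ')
    filter_upwards [h2] with x ⟨k, hk⟩
    refine ⟨k, ?_⟩
    rw [div_eq_iff hd.ne'] at hk
    linear_combination hk
  have h2 := hlat.2.2 _ _ (by positivity) h1
  have h3 : 2 ≤ 2 * Real.pi / |t| := (le_div_iff₀ ht).2 (by linarith)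
  nlinarith

/-- The sum lies in the coset dℤ + nδ almost surely. Positive probability of the mean μ supplies one
good ω₀ showing that nμ lies in that coset too, and differences within it are multiples of d. -/
lemma ae_exists_int_sum_eq {Ω : Type*} [MeasurableSpace Ω] {P : Measure Ω} {X : ℕ → Ω → ℝ}
    {P₀ : Measure ℝ} (hlaw : ∀ i, HasLaw (X i) P₀ P) {d δ μ : ℝ} (hd : d ≠ 0)
    (hlat : OnLattice P₀ d δ) {n : ℕ} (hn : 0 < n)
    (hpos : 0 < P {ω | (1 / (n : ℝ)) * ∑ i ∈ Finset.range n, X i ω = μ}) :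
    ∀ᵐ ω ∂P, ∃ m : ℤ, ∑ i ∈ Finset.range n, (X i ω - μ) / d = m := by
  have hall : ∀ᵐ ω ∂P, ∀ i, ∃ k : ℤ, X i ω = k * d + δ := by
    rw [ae_all_iff]
    intro i
    have := (hlaw i).map_eq ▸ hlat
    exact ae_of_ae_map (hlaw i).aemeasurable this
  have hsum : ∀ ω, (∀ i, ∃ k : ℤ, X i ω = k * d + δ) → ∃ k : ℤ,
      ∑ i ∈ Finset.range n, X i ω = k * d + n * δ := by
    intro ω hω
    choose k hk using hω
    refine ⟨∑ i ∈ Finset.range n, k i, ?_⟩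
    simp_rw [hk]
    rw [Finset.sum_add_distrib, ← Finset.sum_mul]
    simp
  obtain ⟨ω₀, h1, h2⟩ : ∃ ω, (1 / (n : ℝ)) * ∑ i ∈ Finset.range n, X i ω = μ ∧
      ∀ i, ∃ k : ℤ, X i ω = k * d + δ := by
    by_contra! hno
    refine hpos.ne' (measure_mono_null (fun ω hω => ?_) (ae_iff.1 hall))
    obtain ⟨i, hi⟩ := hno ω hω
    simp only [Set.mem_ofPred_eq, not_forall, not_exists]
    exact ⟨i, hi⟩
  obtain ⟨k₀, hk₀⟩ := hsum ω₀ h2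
  have hn' : (n : ℝ) ≠ 0 := by positivity
  have hμ : n * μ = k₀ * d + n * δ := by
    rw [← h1, ← hk₀]; field_simp
  filter_upwards [hall] with ω hω
  obtain ⟨k, hk⟩ := hsum ω hω
  refine ⟨k - k₀, ?_⟩
  rw [← Finset.sum_div, Finset.sum_sub_distrib, hk, div_eq_iff hd]
  simp
  linear_combination -hμ

/-- The Bahadur–Rao estimate in terms of the information divergence and the variance function. -/
theorem exists_abs_measureReal_div_sub_one_le {Ω : Type*} [MeasurableSpace Ω] {P : Measure Ω}
    [IsProbabilityMeasure P] {X : ℕ → Ω → ℝ} {P₀ : Measure ℝ} [IsProbabilityMeasure P₀]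
    (hlaw : ∀ i, HasLaw (X i) P₀ P) (hindep : iIndepFun X P) {d δ : ℝ}
    (hlat : IsLatticeOf P₀ d δ) {β μ : ℝ} (hβ : 0 < β) (hmean : HasMean P₀ β μ)
    (hβi : β ∈ interior (integrableExpSet id P₀)) :
    ∃ C, ∀ n : ℕ, 0 < n → 0 < P {ω | (1 / (n : ℝ)) * ∑ i ∈ Finset.range n, X i ω = μ} →
      |P.real {ω | μ ≤ (1 / (n : ℝ)) * ∑ i ∈ Finset.range n, X i ω}
        / (Real.exp (-(n * divFun P₀ μ)) * (d / (1 - Real.exp (-d * β)))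
          / (√(2 * Real.pi) * √n * √(varFun P₀ μ))) - 1| ≤ C / n := by
  have hnd := hlat.not_ae_eq_const
  have hd := hlat.1
  have hm : Measurable fun x : ℝ => (x - μ) / d := by fun_prop
  have : IsProbabilityMeasure (expFamily P₀ β) := isProbabilityMeasure_tilted hmean.1
  have hV : 0 < varFun P₀ μ := by
    rw [hmean.varFun_eq (hnd μ)]; exact integral_sq_sub_tilted_pos μ (hnd μ) hβi
  set V := varFun P₀ μ with hVdef
  set ν := P₀.map fun x => (x - μ) / d with hν
  have htilt : ν.tilted (fun y => d * β * y) = (expFamily P₀ β).map fun x => (x - μ) / d :=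
    tilted_map_sub_div hd.ne'
  have hexp : ∀ x : ℝ, Real.exp (d * β * ((x - μ) / d))
      = Real.exp (-(β * μ)) * Real.exp (β * x) := fun x => by
    rw [← Real.exp_add]; congr 1; field_simp; ring
  have hint : Integrable (fun y => Real.exp (d * β * y)) ν := by
    rw [hν, integrable_map_measure (by fun_prop) hm.aemeasurable]
    exact (hmean.1.const_mul (Real.exp (-(β * μ)))).congr (ae_of_all _ fun x => (hexp x).symm)
  -- Exponential rate: the moment generating function of the standardized step at dβ is exp(κ(β) −
  -- βμ), κ the cumulant generating function, and D(μ) = βμ − κ(β).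
  have hρ : ∫ y, Real.exp (d * β * y) ∂ν = Real.exp (-divFun P₀ μ) := by
    rw [hν, integral_map hm.aemeasurable (by fun_prop)]
    simp_rw [hexp]
    rw [integral_const_mul, hmean.divFun_eq (hnd μ), neg_sub, sub_eq_add_neg, Real.exp_add,
      exp_cgf (X := id) hmean.1, mul_comm]
    rfl
  have h4 : MemLp id 4 (ν.tilted fun y => d * β * y) := by
    rw [htilt, memLp_map_measure_iff (by fun_prop) hm.aemeasurable]
    have h : MemLp (fun x : ℝ => x) 4 (expFamily P₀ β) := by
      exact_mod_cast memLp_tilted_mul hβi 4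
    refine ((h.sub (memLp_const μ)).mul_const d⁻¹).ae_eq (ae_of_all _ fun x => ?_)
    simp [div_eq_mul_inv]
  have h0 : ∫ y, y ∂(ν.tilted fun y => d * β * y) = 0 := by
    rw [htilt, integral_map hm.aemeasurable (by fun_prop), integral_div,
      integral_sub hmean.2.1 (integrable_const _), hmean.2.2]
    simp
  have hv : ∫ y, y ^ 2 ∂(ν.tilted fun y => d * β * y) = V / d ^ 2 := by
    rw [htilt, integral_map hm.aemeasurable (by fun_prop), hVdef, hmean.varFun_eq (hnd μ)]
    simp_rw [div_pow]
    rw [integral_div]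
  have hcf : ∀ t, 0 < |t| → |t| ≤ Real.pi → ‖charFun (ν.tilted fun y => d * β * y) t‖ < 1 := by
    rw [htilt]
    exact fun t ht htπ => norm_charFun_map_expFamily_lt_one hmean.1 hlat ht htπ
  have hYlaw : ∀ i, HasLaw (fun ω => (X i ω - μ) / d) ν P := fun i =>
    HasLaw.comp ⟨hm.aemeasurable, hν.symm⟩ (hlaw i)
  have hYindep : iIndepFun (fun i ω => (X i ω - μ) / d) P :=
    hindep.comp (fun _ x => (x - μ) / d) fun _ => hm
  obtain ⟨C, hC⟩ := abs_measureReal_sum_nonneg_sub_le hYlaw hYindep (mul_pos hd hβ) hint h4 h0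
    (by rw [hv]; positivity) hcf
  rw [hv, hρ] at hC
  have hq : 0 < 1 - Real.exp (-(d * β)) := by
    have : Real.exp (-(d * β)) < 1 := by
      rw [← Real.exp_zero, Real.exp_lt_exp]; linarith [mul_pos hd hβ]
    linarith
  -- Dividing the absolute error by the leading term cancels the exponential and one √n; this
  -- constant over n is what remains.
  refine ⟨C * (√(2 * Real.pi) * √V * (1 - Real.exp (-(d * β))) / d), fun n hn hpos => ?_⟩
  have h := hC n hn (ae_exists_int_sum_eq hlaw hd.ne' hlat.2.1 hn hpos)
  have hn' : (0 : ℝ) < n := by exact_mod_cast hn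
  have hset : {ω | 0 ≤ ∑ i ∈ Finset.range n, (X i ω - μ) / d}
      = {ω | μ ≤ (1 / (n : ℝ)) * ∑ i ∈ Finset.range n, X i ω} := by
    ext ω
    rw [Set.mem_ofPred_eq, Set.mem_ofPred_eq, ← Finset.sum_div, Finset.sum_sub_distrib, le_div_iff₀ hd, one_div_mul_eq_div,
      le_div_iff₀ hn']
    simp
    rw [mul_comm]
  rw [hset, ← Real.exp_nat_mul, mul_neg] at h
  set p := P.real {ω | μ ≤ (1 / (n : ℝ)) * ∑ i ∈ Finset.range n, X i ω}
  set E := Real.exp (-(n * divFun P₀ μ)) with hE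
  have hEpos : 0 < E := Real.exp_pos _
  rw [neg_mul]
  set q := 1 - Real.exp (-(d * β))
  set A := E * (d / q) / (√(2 * Real.pi) * √n * √V) with hA
  have hApos : 0 < A := by positivity
  have hA' : E * q⁻¹ / √(2 * Real.pi * n * (V / d ^ 2)) = A := by
    rw [Real.sqrt_mul (x := 2 * Real.pi * n) (by positivity),
      Real.sqrt_mul (x := 2 * Real.pi) (by positivity), Real.sqrt_div hV.le, Real.sqrt_sq hd.le, hA]
    field_simp
  rw [hA'] at h
  rw [div_sub_one hApos.ne', abs_div, abs_of_pos hApos, div_le_iff₀ hApos]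
  refine h.trans (le_of_eq ?_)
  rw [hA]
  have : (0 : ℝ) < √n := Real.sqrt_pos.2 hn'
  have : (0 : ℝ) < √V := Real.sqrt_pos.2 hV
  have : 0 < √(2 * Real.pi) := Real.sqrt_pos.2 (by positivity)
  field_simp

/-- The Gaussian approximation matches the leading term of the Bahadur–Rao estimate. -/
theorem stdGaussianCDF_div_sub_one_isBigO {P₀ : Measure ℝ} [IsProbabilityMeasure P₀] {d δ : ℝ}
    (hlat : IsLatticeOf P₀ d δ) {β μ : ℝ} (hβ : 0 < β) (hmean : HasMean P₀ β μ)
    (hβi : β ∈ interior (integrableExpSet id P₀)) (hμ₀ : ∫ x, x ∂P₀ ≠ μ) :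
    (fun n : ℕ => stdGaussianCDF (-√n * √(2 * divFun P₀ (μ - latticeC P₀ d μ / n)))
        / (Real.exp (-(n * divFun P₀ μ)) * (d / (1 - Real.exp (-d * β)))
          / (√(2 * Real.pi) * √n * √(varFun P₀ μ))) - 1)
      =O[atTop] fun n : ℕ => 1 / (n : ℝ) := by
  have hnd := hlat.not_ae_eq_const
  have hd := hlat.1
  have hV : 0 < varFun P₀ μ := by
    rw [hmean.varFun_eq (hnd μ)]; exact integral_sq_sub_tilted_pos μ (hnd μ) hβi
  have hD : 0 < divFun P₀ μ := hmean.divFun_pos (hnd μ) hμ₀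
  have hq : 0 < 1 - Real.exp (-d * β) := by
    have : Real.exp (-d * β) < 1 := by
      rw [← Real.exp_zero, Real.exp_lt_exp]; linarith [mul_pos hd hβ]
    linarith
  set V := varFun P₀ μ
  set D := divFun P₀ μ with hDdef
  set q := 1 - Real.exp (-d * β) with hqdef
  set c := latticeC P₀ d μ with hc
  -- The defining property of c: this factor exchanges the Gaussian prefactor 1/√(2D) for the
  -- lattice prefactor d/(q√V).
  have hcβ : Real.exp (c * β) = √(2 * D) / (√V * (q / d)) := by
    rw [hc, latticeC, hmean.mle_eq (hnd μ), div_mul_cancel₀ _ hβ.ne', Real.exp_log]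
    have : (0 : ℝ) < √V := Real.sqrt_pos.2 hV
    have : 0 < √(2 * D) := Real.sqrt_pos.2 (by positivity)
    positivity
  set Dn : ℕ → ℝ := fun n => divFun P₀ (μ - c / n) with hDn
  have hmn : Tendsto (fun n : ℕ => μ - c / n) atTop (nhds μ) := by
    simpa using (tendsto_const_div_atTop_nhds_zero_nat c).const_sub μ
  have hexpand : (fun n : ℕ => Dn n - D + β * (c / n)) =O[atTop] fun n : ℕ => (1 / (n : ℝ)) ^ 2 := by
    have h1 := (divFun_sub_sub_isBigO hnd hmean hβi).comp_tendsto hmn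
    have h2 : (fun n : ℕ => (μ - c / n - μ) ^ 2) =O[atTop] fun n : ℕ => (1 / (n : ℝ)) ^ 2 := by
      refine IsBigO.of_bound (c ^ 2) (Eventually.of_forall fun n => le_of_eq ?_)
      rw [norm_pow, norm_pow, Real.norm_eq_abs, Real.norm_eq_abs, sq_abs, sq_abs]
      ring
    refine (h1.trans h2).congr_left fun n => ?_
    simp only [Function.comp, hDn]
    ring
  have hDnD : (fun n => Dn n - D) =O[atTop] fun n : ℕ => 1 / (n : ℝ) := by
    have h1 : (fun n : ℕ => (1 / (n : ℝ)) ^ 2) =O[atTop] fun n : ℕ => 1 / (n : ℝ) := by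
      simpa [sq] using (isBigO_refl (fun n : ℕ => 1 / (n : ℝ)) atTop).mul
        ((tendsto_one_div_atTop_nhds_zero_nat (𝕜 := ℝ)).isBigO_one ℝ)
    have h2 : (fun n : ℕ => β * (c / n)) =O[atTop] fun n : ℕ => 1 / (n : ℝ) :=
      IsBigO.of_bound (|β * c|) (Eventually.of_forall fun n => le_of_eq (by
        rw [Real.norm_eq_abs, Real.norm_eq_abs, ← abs_mul]; congr 1; ring))
    exact ((hexpand.trans h1).sub h2).congr_left fun n => by ring
  have hDlim := tendsto_of_sub_isBigO_one_div hDnD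
  have hDpos : ∀ᶠ n in atTop, D / 2 < Dn n := hDlim.eventually_const_lt (by linarith)
  -- The quotient is a product of three factors, each 1 + O(1/n): the remainder in the exponent, the
  -- replacement of √(2D) by its shifted value in the prefactor, and the Mills ratio error.
  have f1 : (fun n : ℕ => Real.exp (-(n * (Dn n - D + β * (c / n)))) - 1)
      =O[atTop] fun n : ℕ => 1 / (n : ℝ) := by
    have h1 : (fun n : ℕ => -(n * (Dn n - D + β * (c / n))) - 0)
        =O[atTop] fun n : ℕ => 1 / (n : ℝ) := by
      have h2 := ((isBigO_refl (fun n : ℕ => (n : ℝ)) atTop).mul hexpand).neg_left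
      refine (h2.congr_left fun n => by ring).trans_eventuallyEq ?_
      filter_upwards [eventually_gt_atTop 0] with n hn
      have : (n : ℝ) ≠ 0 := by positivity
      field_simp
    simpa using comp_sub_isBigO_one_div (Real.hasDerivAt_exp 0) h1
  have f2 : (fun n => √(2 * D) / √(2 * Dn n) - 1) =O[atTop] fun n : ℕ => 1 / (n : ℝ) := by
    have h0 : √(2 * D) ≠ 0 := (Real.sqrt_pos.2 (by positivity)).ne'
    have hder : DifferentiableAt ℝ (fun x => √(2 * D) / √(2 * x)) D :=
      (differentiableAt_const _).div ((differentiableAt_id.const_mul 2).sqrt (by simp [hD.ne'])) h0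
    have := comp_sub_isBigO_one_div hder.hasDerivAt hDnD
    simpa only [div_self h0] using this
  have f3 : (fun n : ℕ => stdGaussianCDF (-(√n * √(2 * Dn n)))
      / (Real.exp (-((√n * √(2 * Dn n)) ^ 2 / 2)) / (√(2 * Real.pi) * (√n * √(2 * Dn n)))) - 1)
      =O[atTop] fun n : ℕ => 1 / (n : ℝ) := by
    refine IsBigO.of_bound (1 / D) ?_
    filter_upwards [hDpos, eventually_gt_atTop 0] with n h1 hn
    have hn' : (0 : ℝ) < n := by exact_mod_cast hn
    have h2 : 0 < √(n : ℝ) * √(2 * Dn n) :=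
      mul_pos (Real.sqrt_pos.2 hn') (Real.sqrt_pos.2 (by linarith))
    refine (abs_stdGaussianCDF_neg_div_sub_one_le h2).trans ?_
    rw [mul_pow, Real.sq_sqrt hn'.le, Real.sq_sqrt (by linarith), Real.norm_of_nonneg (by positivity),
      ← one_div_mul_one_div, mul_comm]
    gcongr
    linarith
  refine (mul_sub_one_isBigO_one_div (mul_sub_one_isBigO_one_div f1 f2) f3).congr' ?_ .rfl
  filter_upwards [hDpos, eventually_gt_atTop 0] with n h1 hn
  have hn' : (0 : ℝ) < n := by exact_mod_cast hn
  have hsn : 0 < √(n : ℝ) := Real.sqrt_pos.2 hn'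
  have hsD : 0 < √(2 * Dn n) := Real.sqrt_pos.2 (by linarith)
  have hsV : 0 < √V := Real.sqrt_pos.2 hV
  have hsp : 0 < √(2 * Real.pi) := Real.sqrt_pos.2 (by positivity)
  rw [mul_pow, Real.sq_sqrt hn'.le, Real.sq_sqrt (by linarith), neg_mul]
  have he1 : Real.exp (-(n * (Dn n - D + β * (c / n))))
      = Real.exp (-(n * Dn n)) / (Real.exp (-(n * D)) * Real.exp (c * β)) := by
    rw [← Real.exp_add, ← Real.exp_sub]
    congr 1
    field_simp
    ring
  have he2 : Real.exp (-((n : ℝ) * (2 * Dn n) / 2)) = Real.exp (-(n * Dn n)) := by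
    congr 1; ring
  rw [he1, he2, hcβ]
  have hs2D : 0 < √(2 * D) := Real.sqrt_pos.2 (by positivity)
  congr 1
  generalize stdGaussianCDF (-(√(n : ℝ) * √(2 * Dn n))) = Φ
  have e1 := (Real.exp_pos (-(n * Dn n)))
  have e2 := (Real.exp_pos (-(n * D)))
  generalize √(2 * Dn n) = y at hsD ⊢
  generalize √(2 * D) = z at hs2D ⊢
  field_simp

end TailApprox

/-! ### Comparison of the two sides -/

theorem theorem2 {Ω : Type*} [MeasurableSpace Ω] (P : Measure Ω) [IsProbabilityMeasure P]
    (X : ℕ → Ω → ℝ) (P₀ : Measure ℝ)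
    (hlaw : ∀ i, HasLaw (X i) P₀ P) (hindep : iIndepFun X P)
    (hmgf : ∃ r > 0, ∀ β : ℝ, |β| < r → Integrable (fun x => Real.exp (β * x)) P₀)
    (d δ : ℝ) (hlattice : TailApprox.IsLatticeOf P₀ d δ)
    (μ : ℝ) (hμ₀ : ∫ x, x ∂P₀ < μ) (hμ : (μ : EReal) < TailApprox.muStar P₀) :
    ∃ ε : ℕ → ℝ, ε =O[atTop] (fun n : ℕ => 1 / (n : ℝ)) ∧
      ∀ᶠ n : ℕ in atTop, 0 < P {ω | (1 / (n : ℝ)) * ∑ i ∈ Finset.range n, X i ω = μ} →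
        P.real {ω | μ ≤ (1 / (n : ℝ)) * ∑ i ∈ Finset.range n, X i ω} =
          TailApprox.stdGaussianCDF
            (-Real.sqrt n *
              Real.sqrt (2 * TailApprox.divFun P₀ (μ - TailApprox.latticeC P₀ d μ / n))) *
            (1 + ε n) := by
  classical
  have : IsProbabilityMeasure P₀ := (hlaw 0).isProbabilityMeasure_iff.1 inferInstance
  have h0 : (0 : ℝ) ∈ interior (integrableExpSet id P₀) := by
    obtain ⟨r, hr, h⟩ := hmgf
    rw [mem_interior_iff_mem_nhds]
    filter_upwards [Metric.ball_mem_nhds (0 : ℝ) hr] with β hβ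
    exact h β (by simpa using hβ)
  have hid : Integrable (fun x => x) P₀ := integrable_of_mem_interior_integrableExpSet h0
  obtain ⟨β, hβ, hmean, hβi⟩ := TailApprox.exists_hasMean_of_lt_muStar hid hμ₀ hμ
  obtain ⟨C, hC⟩ :=
    TailApprox.exists_abs_measureReal_div_sub_one_le hlaw hindep hlattice hβ hmean hβi
  have hb := TailApprox.stdGaussianCDF_div_sub_one_isBigO hlattice hβ hmean hβi hμ₀.ne
  set A : ℕ → ℝ := fun n => Real.exp (-(n * TailApprox.divFun P₀ μ))
    * (d / (1 - Real.exp (-d * β))) / (√(2 * Real.pi) * √n * √(TailApprox.varFun P₀ μ)) with hA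
  set p : ℕ → ℝ := fun n => P.real {ω | μ ≤ (1 / (n : ℝ)) * ∑ i ∈ Finset.range n, X i ω} with hp
  set Φ : ℕ → ℝ := fun n => TailApprox.stdGaussianCDF
    (-√n * √(2 * TailApprox.divFun P₀ (μ - TailApprox.latticeC P₀ d μ / n))) with hΦ
  -- The default value 1 at the excluded n, where the lattice estimate is not available, makes a n −
  -- 1 = O(1/n) hold along the whole sequence.
  set a : ℕ → ℝ := fun n =>
    if 0 < n ∧ 0 < P {ω | (1 / (n : ℝ)) * ∑ i ∈ Finset.range n, X i ω = μ} then p n / A n else 1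
    with ha
  have haO : (fun n => a n - 1) =O[atTop] fun n : ℕ => 1 / (n : ℝ) := by
    refine IsBigO.of_bound |C| (Eventually.of_forall fun n => ?_)
    simp only [ha]
    split_ifs with h
    · refine (hC n h.1 h.2).trans ?_
      rw [Real.norm_of_nonneg (by positivity), mul_one_div]
      gcongr
      exact le_abs_self C
    · simp; positivity
  have hbinv : (fun n => (Φ n / A n)⁻¹ - 1) =O[atTop] fun n : ℕ => 1 / (n : ℝ) := by
    simpa only [inv_one] using TailApprox.comp_sub_isBigO_one_div (hasDerivAt_inv one_ne_zero) hb
  refine ⟨fun n => a n * (Φ n / A n)⁻¹ - 1,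
    TailApprox.mul_sub_one_isBigO_one_div haO hbinv, ?_⟩
  -- The ratio tends to 1, so eventually neither Φ n nor A n is zero and the divisions in the error
  -- term can be undone.
  have hlim := TailApprox.tendsto_of_sub_isBigO_one_div hb
  filter_upwards [eventually_gt_atTop 0, hlim.eventually_ne one_ne_zero] with n hn hne hpos
  have hne' : Φ n / A n ≠ 0 := hne
  obtain ⟨h1, h2⟩ := div_ne_zero_iff.1 hne'
  change p n = Φ n * (1 + (a n * (Φ n / A n)⁻¹ - 1))
  simp only [ha, if_pos (And.intro hn hpos)]
  field_simp
  ring
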